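/- Let $(M,g)$ be a connected smooth Riemannian manifold (without boundary) of dimension $m$, with Levi-Civita connection $\nabla$, and suppose that it is Einstein in the sense that $\operatorname{Ricci}(X)=\lambda X$ for every tangent vector $X$, where $\lambda\in\mathbb R$ is a constant and $\operatorname{Ricci}(X)=\sum_{i}R(X,E_i)E_i$ for an orthonormal frame $(E_i)$, with $R(X,Y)Z=\nabla_X\nabla_YZ-\nabla_Y\nabla_XZ-\nabla_{[X,Y]}Z$. Let $f:M\to(0,+\infty)$ be a smooth function such that $\operatorname{grad}f\neq 0$ at every point of $M$, and put $\alpha=1+\|\operatorname{grad}f\|^2$. Let $g^f$ be the Mus-Gradient metric on the tangent bundle $TM$, that is, the Riemannian metric determined by $$g^f(X^H,Y^H)_{(x,u)}=g_x(X,Y),\qquad g^f(X^H,Y^V)_{(x,u)}=0,\qquad g^f(X^V,Y^V)_{(x,u)}=g_x(X,Y)+X_x(f)\,Y_x(f),$$ where $X^H$ and $X^V$ denote the horizontal lift (with respect to $\nabla$) and the vertical lift of $X$ to $TM$. Then the canonical projection $\pi:(TM,g^f)\to(M,g)$ is biharmonic if and only if the function $$\lambda\ln\alpha+\tfrac12\,\Delta\ln\alpha+\tfrac18\,\|\operatorname{grad}\ln\alpha\|^2$$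 is constant on $M$, where $\Delta=\operatorname{div}\operatorname{grad}$. Here a smooth map $\varphi:(P,k)\to(N,h)$ of Riemannian manifolds, with tension field $\tau(\varphi)=\operatorname{Tr}_k\nabla d\varphi$, is called biharmonic if its bitension field $$\tau_2(\varphi)=-\operatorname{Tr}_kR^N(\tau(\varphi),d\varphi)d\varphi-\operatorname{Tr}_k\big(\nabla^{\varphi}\nabla^{\varphi}\tau(\varphi)-\nabla^{\varphi}_{\nabla^{P}}\tau(\varphi)\big)$$ vanishes identically, where $\nabla^\varphi$ is the pull-back connection on $\varphi^*TN$. -/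

import Mathlib

open Bundle
open scoped Manifold ContDiff

set_option maxSynthPendingDepth 3

noncomputable section

/-! ### Riemannian geometry in coordinates

`E` and `F` are finite-dimensional real vector spaces, in which coordinate domains live. A metric in
coordinates is a function `G : E → E →L[ℝ] E →L[ℝ] ℝ`; all formulas below are pointwise and use
the values of `G` near the point only. -/

namespace LocalRiem

variable {E : Type*} [NormedAddCommGroup E] [NormedSpace ℝ E]
  {F : Type*} [NormedAddCommGroup F] [NormedSpace ℝ F]

/-- The musical isomorphism of a nondegenerate bilinear form `B`: it sends a covector `ℓ` to the
vector `w` with `B w = ℓ`. -/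
def sharp (B : E →L[ℝ] E →L[ℝ] ℝ) : (E →L[ℝ] ℝ) →L[ℝ] E :=
  ContinuousLinearMap.inverse B

/-- The trace `∑ B^{ij} A(eᵢ, eⱼ)` of a (vector valued) bilinear map `A` with respect to the
nondegenerate symmetric form `B`; it is the sum of the `A(eᵢ, eᵢ)` over a `B`-orthonormal basis and
does not depend on the basis that is used. -/
def trace [FiniteDimensional ℝ E] (B : E →L[ℝ] E →L[ℝ] ℝ) (A : E → E → F) : F :=
  ∑ i, A (Module.finBasis ℝ E i)
    (sharp B (LinearMap.toContinuousLinearMap ((Module.finBasis ℝ E).coord i)))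

/-- The Christoffel symbols `Γ(v, w)` of the Levi-Civita connection of the metric `G`. They are
determined by `2 G(Γ(v, w), u) = (∂_v G)(w, u) + (∂_w G)(v, u) - (∂_u G)(v, w)`. -/
def christoffel (G : E → E →L[ℝ] E →L[ℝ] ℝ) (z : E) : E →L[ℝ] E →L[ℝ] E :=
  ContinuousLinearMap.compL ℝ E (E →L[ℝ] ℝ) E (sharp (G z)) ∘L
    ((1 / 2 : ℝ) • (fderiv ℝ G z + (fderiv ℝ G z).flip
      - ((ContinuousLinearMap.flipₗᵢ ℝ E E ℝ).toContinuousLinearEquiv :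
          (E →L[ℝ] E →L[ℝ] ℝ) →L[ℝ] (E →L[ℝ] E →L[ℝ] ℝ)) ∘L (fderiv ℝ G z).flip))

theorem christoffel_apply (G : E → E →L[ℝ] E →L[ℝ] ℝ) (z v w : E) :
    christoffel G z v w = sharp (G z) ((1 / 2 : ℝ) •
      (fderiv ℝ G z v w + fderiv ℝ G z w v - ((fderiv ℝ G z).flip v).flip w)) := rfl

theorem apply_christoffel (G : E → E →L[ℝ] E →L[ℝ] ℝ) (z v w u : E)
    (hG : (G z).IsInvertible) :
    2 * G z (christoffel G z v w) u =
      fderiv ℝ G z v w u + fderiv ℝ G z w v u - fderiv ℝ G z u v w := by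
  have h : G z (christoffel G z v w) = (1 / 2 : ℝ) •
      (fderiv ℝ G z v w + fderiv ℝ G z w v - ((fderiv ℝ G z).flip v).flip w) := by
    rw [christoffel_apply, sharp]
    exact hG.self_apply_inverse _
  rw [h]
  simp

/-- The curvature tensor `R(X, Y) Z = ∇_X ∇_Y Z - ∇_Y ∇_X Z - ∇_[X,Y] Z` of the metric `G`. -/
def curvature (G : E → E →L[ℝ] E →L[ℝ] ℝ) (z : E) (X Y Z : E) : E :=
  fderiv ℝ (fun y => christoffel G y Y Z) z X - fderiv ℝ (fun y => christoffel G y X Z) z Y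
    + christoffel G z X (christoffel G z Y Z) - christoffel G z Y (christoffel G z X Z)

/-- The Ricci endomorphism `Ricci(X) = ∑ R(X, Eᵢ) Eᵢ`, for an orthonormal frame `(Eᵢ)`. -/
def ricci [FiniteDimensional ℝ E] (G : E → E →L[ℝ] E →L[ℝ] ℝ) (z : E) (X : E) : E :=
  trace (G z) fun Y Z => curvature G z X Y Z

/-- The Laplacian `Δ u = Tr_G ∇du` of a function `u` (the trace of the Hessian, which is the
divergence of the gradient). -/
def laplacian [FiniteDimensional ℝ E] (G : E → E →L[ℝ] E →L[ℝ] ℝ) (u : E → ℝ) (z : E) : ℝ :=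
  trace (G z) fun X Y =>
    fderiv ℝ (fun z' => fderiv ℝ u z' Y) z X - fderiv ℝ u z (christoffel G z X Y)

/-- The pull-back connection: `∇^φ_X V` at `z`, for a vector field `V` along the map `φ` into a
domain with metric `H`. -/
def covAlong (H : F → F →L[ℝ] F →L[ℝ] ℝ) (φ V : E → F) (z X : E) : F :=
  fderiv ℝ V z X + christoffel H (φ z) (fderiv ℝ φ z X) (V z)

/-- The tension field `τ(φ) = Tr_G ∇dφ`, where
`∇dφ(X, Y) = ∇^φ_X (dφ(Y)) - dφ(∇_X Y)`. -/
def tension [FiniteDimensional ℝ E] (G : E → E →L[ℝ] E →L[ℝ] ℝ) (H : F → F →L[ℝ] F →L[ℝ] ℝ)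
    (φ : E → F) (z : E) : F :=
  trace (G z) fun X Y =>
    covAlong H φ (fun z' => fderiv ℝ φ z' Y) z X - fderiv ℝ φ z (christoffel G z X Y)

/-- The Jacobi operator of `φ` on vector fields `V` along `φ`:
`J_φ(V) = - Tr_G R^H(V, dφ) dφ - Tr_G (∇^φ ∇^φ V - ∇^φ_∇ V)`. -/
def jacobi [FiniteDimensional ℝ E] (G : E → E →L[ℝ] E →L[ℝ] ℝ) (H : F → F →L[ℝ] F →L[ℝ] ℝ)
    (φ V : E → F) (z : E) : F :=
  - trace (G z) (fun X Y => curvature H (φ z) (V z) (fderiv ℝ φ z X) (fderiv ℝ φ z Y))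
    - trace (G z) fun X Y =>
        covAlong H φ (fun z' => covAlong H φ V z' Y) z X - covAlong H φ V z (christoffel G z X Y)

/-- The bitension field `τ₂(φ) = J_φ(τ(φ))`. -/
def bitension [FiniteDimensional ℝ E] (G : E → E →L[ℝ] E →L[ℝ] ℝ) (H : F → F →L[ℝ] F →L[ℝ] ℝ)
    (φ : E → F) (z : E) : F :=
  jacobi G H φ (tension G H φ) z

end LocalRiem

/-! ### Riemannian geometry on manifolds

A metric is given as a family `g` of bilinear forms on the tangent spaces. The tensorial quantities
at a point `x` are computed in the preferred chart at `x`, through which Mathlib identifies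
`TangentSpace I x` with the model space `E`. -/

namespace Riem

variable {E : Type*} [NormedAddCommGroup E] [NormedSpace ℝ E]
  {H : Type*} [TopologicalSpace H] (I : ModelWithCorners ℝ E H)
  {M : Type*} [TopologicalSpace M] [ChartedSpace H M]
  {E' : Type*} [NormedAddCommGroup E'] [NormedSpace ℝ E']
  {H' : Type*} [TopologicalSpace H'] (I' : ModelWithCorners ℝ E' H')
  {M' : Type*} [TopologicalSpace M'] [ChartedSpace H' M']

/-- A bilinear form on `TangentSpace I x`, seen on the model space. -/
def formOnModel {x : M} (B : TangentSpace I x →L[ℝ] TangentSpace I x →L[ℝ] ℝ) :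
    E →L[ℝ] E →L[ℝ] ℝ :=
  B

/-- The components of `g` in the preferred chart at `x₀`: the pull-back of `g` under the inverse of
this chart. -/
def metricInChart (g : ∀ x : M, TangentSpace I x →L[ℝ] TangentSpace I x →L[ℝ] ℝ) (x₀ : M) (z : E) :
    E →L[ℝ] E →L[ℝ] ℝ :=
  (formOnModel I (g ((extChartAt I x₀).symm z))).bilinearComp
    (mfderiv 𝓘(ℝ, E) I (extChartAt I x₀).symm z : E →L[ℝ] E)
    (mfderiv 𝓘(ℝ, E) I (extChartAt I x₀).symm z : E →L[ℝ] E)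

/-- The Christoffel symbols of `g` at `x`, in the preferred chart at `x`. -/
def christoffelAt (g : ∀ x : M, TangentSpace I x →L[ℝ] TangentSpace I x →L[ℝ] ℝ) (x : M) :
    E →L[ℝ] E →L[ℝ] E :=
  LocalRiem.christoffel (metricInChart I g x) (extChartAt I x x)

/-- The Ricci endomorphism of `g` at `x`. -/
def ricci [FiniteDimensional ℝ E]
    (g : ∀ x : M, TangentSpace I x →L[ℝ] TangentSpace I x →L[ℝ] ℝ) (x : M) (X : TangentSpace I x) :
    TangentSpace I x :=
  LocalRiem.ricci (E := E) (metricInChart I g x) (extChartAt I x x) X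

/-- The gradient of `u`: `g(grad u, X) = du(X)`. -/
def grad (g : ∀ x : M, TangentSpace I x →L[ℝ] TangentSpace I x →L[ℝ] ℝ) (u : M → ℝ) (x : M) :
    TangentSpace I x :=
  LocalRiem.sharp (formOnModel I (g x)) (mvfderiv I u x : E →L[ℝ] ℝ)

/-- `‖grad u‖²`. -/
def gradNormSq (g : ∀ x : M, TangentSpace I x →L[ℝ] TangentSpace I x →L[ℝ] ℝ) (u : M → ℝ) (x : M) :
    ℝ :=
  g x (grad I g u x) (grad I g u x)

/-- The Laplacian of `u`. -/
def laplacian [FiniteDimensional ℝ E]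
    (g : ∀ x : M, TangentSpace I x →L[ℝ] TangentSpace I x →L[ℝ] ℝ) (u : M → ℝ) (x : M) : ℝ :=
  LocalRiem.laplacian (metricInChart I g x) (u ∘ (extChartAt I x).symm) (extChartAt I x x)

/-- The bitension field `τ₂(φ)` of a map `φ : (M, g) → (M', g')`, a vector field along `φ`. -/
def bitension [FiniteDimensional ℝ E]
    (g : ∀ x : M, TangentSpace I x →L[ℝ] TangentSpace I x →L[ℝ] ℝ)
    (g' : ∀ y : M', TangentSpace I' y →L[ℝ] TangentSpace I' y →L[ℝ] ℝ) (φ : M → M') (x : M) :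
    TangentSpace I' (φ x) :=
  LocalRiem.bitension (E := E) (F := E') (metricInChart I g x) (metricInChart I' g' (φ x))
    (writtenInExtChartAt I I' x φ) (extChartAt I x x)

/-- A smooth map is biharmonic if its bitension field vanishes. -/
def IsBiharmonic [FiniteDimensional ℝ E]
    (g : ∀ x : M, TangentSpace I x →L[ℝ] TangentSpace I x →L[ℝ] ℝ)
    (g' : ∀ y : M', TangentSpace I' y →L[ℝ] TangentSpace I' y →L[ℝ] ℝ) (φ : M → M') : Prop :=
  ContMDiff I I' ∞ φ ∧ ∀ x, bitension I I' g g' φ x = 0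

/-! ### The tangent bundle

The preferred chart of `TM` at `p = (x, u)` is the chart `(xⁱ, yⁱ)` induced by the preferred chart
`(xⁱ)` at `x`, so that a tangent vector `aⁱ ∂/∂xⁱ + bⁱ ∂/∂yⁱ` at `p` is the pair `(a, b)`. -/

section TangentBundle

variable [IsManifold I 1 M]

/-- The differential `(a, b) ↦ a` of the canonical projection `π : TM → M` at `p`. -/
def projDeriv (p : TangentBundle I M) : TangentSpace I.tangent p →L[ℝ] TangentSpace I p.1 :=
  (ContinuousLinearMap.fst ℝ E E : E × E →L[ℝ] E)

theorem mfderiv_proj (p : TangentBundle I M) :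
    mfderiv I.tangent I (fun q : TangentBundle I M => q.1) p = projDeriv I p := by
  have hsm : MDifferentiableAt I.tangent I (fun q : TangentBundle I M => q.1) p :=
    (Bundle.contMDiffAt_proj (n := 1) (TangentSpace I : M → Type _)).mdifferentiableAt (by simp)
  rw [hsm.mfderiv]
  have hu : UniqueDiffWithinAt ℝ (Set.range I.tangent) (extChartAt I.tangent p p) :=
    I.tangent.uniqueDiffWithinAt_image
  have heq : writtenInExtChartAt I.tangent I p (fun q : TangentBundle I M => q.1)
      =ᶠ[nhdsWithin (extChartAt I.tangent p p) (Set.range I.tangent)] (Prod.fst : E × E → E) := by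
    filter_upwards [extChartAt_target_mem_nhdsWithin (I := I.tangent) p] with z hz
    have h1 := congrArg Prod.fst ((extChartAt I.tangent p).right_inv hz)
    rw [← h1]
    simp [writtenInExtChartAt, extChartAt, mfld_simps]
  rw [heq.fderivWithin_eq (heq.self_of_nhdsWithin (Set.mem_range_self _)), fderivWithin_fst hu]
  rfl

/-- The connection map `(a, b) ↦ b + Γ(a, u)` at `p = (x, u)`, whose kernel is the horizontal
space. -/
def connectionMap (g : ∀ x : M, TangentSpace I x →L[ℝ] TangentSpace I x →L[ℝ] ℝ)
    (p : TangentBundle I M) : TangentSpace I.tangent p →L[ℝ] TangentSpace I p.1 :=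
  (ContinuousLinearMap.snd ℝ E E + (christoffelAt I g p.1).flip (p.2 : E) ∘L
    ContinuousLinearMap.fst ℝ E E : E × E →L[ℝ] E)

/-- The vertical lift `X^V = Xⁱ ∂/∂yⁱ` at `p`. -/
def verticalLift (p : TangentBundle I M) (X : TangentSpace I p.1) : TangentSpace I.tangent p :=
  ((0, X) : E × E)

/-- The horizontal lift `X^H = Xⁱ (∂/∂xⁱ - uʲ Γᵢⱼᵏ ∂/∂yᵏ)` at `p = (x, u)`. -/
def horizontalLift (g : ∀ x : M, TangentSpace I x →L[ℝ] TangentSpace I x →L[ℝ] ℝ)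
    (p : TangentBundle I M) (X : TangentSpace I p.1) : TangentSpace I.tangent p :=
  ((X, -christoffelAt I g p.1 X p.2) : E × E)

/-- The fibre form `(X, Y) ↦ g(X, Y) + X(f) Y(f)`. -/
def fibreForm (g : ∀ x : M, TangentSpace I x →L[ℝ] TangentSpace I x →L[ℝ] ℝ) (f : M → ℝ) (x : M) :
    TangentSpace I x →L[ℝ] TangentSpace I x →L[ℝ] ℝ :=
  g x + (mvfderiv I f x).smulRight (mvfderiv I f x)

/-- The Mus-Gradient metric `g^f` on `TM`. Each `ξ` in `T_p TM` is `X^H + Y^V` with `X = dπ(ξ)` and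
`Y` the image of `ξ` under the connection map, and
`g^f(X^H + Y^V, X'^H + Y'^V) = g(X, X') + g(Y, Y') + Y(f) Y'(f)`. -/
def musGradient (g : ∀ x : M, TangentSpace I x →L[ℝ] TangentSpace I x →L[ℝ] ℝ) (f : M → ℝ)
    (p : TangentBundle I M) :
    TangentSpace I.tangent p →L[ℝ] TangentSpace I.tangent p →L[ℝ] ℝ :=
  ((formOnModel I (g p.1)).bilinearComp
      (projDeriv I p : E × E →L[ℝ] E) (projDeriv I p : E × E →L[ℝ] E) +
    (formOnModel I (fibreForm I g f p.1)).bilinearComp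
      (connectionMap I g p : E × E →L[ℝ] E) (connectionMap I g p : E × E →L[ℝ] E) :
    E × E →L[ℝ] E × E →L[ℝ] ℝ)

variable (g : ∀ x : M, TangentSpace I x →L[ℝ] TangentSpace I x →L[ℝ] ℝ) (f : M → ℝ)
  (p : TangentBundle I M)

theorem projDeriv_horizontalLift (X : TangentSpace I p.1) :
    projDeriv I p (horizontalLift I g p X) = X := rfl

theorem projDeriv_verticalLift (X : TangentSpace I p.1) :
    projDeriv I p (verticalLift I p X) = 0 := rfl

theorem connectionMap_horizontalLift (X : TangentSpace I p.1) :
    connectionMap I g p (horizontalLift I g p X) = 0 :=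
  neg_add_cancel (G := E) (christoffelAt I g p.1 X p.2)

theorem connectionMap_verticalLift (X : TangentSpace I p.1) :
    connectionMap I g p (verticalLift I p X) = X := by
  have h (X : E) : X + (christoffelAt I g p.1).flip (p.2 : E) 0 = X := by
    rw [map_zero, add_zero]
  exact h X

theorem horizontalLift_add_verticalLift (ξ : TangentSpace I.tangent p) :
    horizontalLift I g p (projDeriv I p ξ) + verticalLift I p (connectionMap I g p ξ) = ξ := by
  obtain ⟨a, b⟩ := (ξ : E × E)
  have h : ((a, -christoffelAt I g p.1 a p.2) : E × E) +
      (0, b + christoffelAt I g p.1 a p.2) = (a, b) := by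
    simp
  exact h

theorem musGradient_apply (ξ η : TangentSpace I.tangent p) :
    musGradient I g f p ξ η = g p.1 (projDeriv I p ξ) (projDeriv I p η) +
      (g p.1 (connectionMap I g p ξ) (connectionMap I g p η) +
        mvfderiv I f p.1 (connectionMap I g p ξ) * mvfderiv I f p.1 (connectionMap I g p η)) :=
  rfl

theorem musGradient_horizontal_horizontal (X Y : TangentSpace I p.1) :
    musGradient I g f p (horizontalLift I g p X) (horizontalLift I g p Y) = g p.1 X Y := by
  simp [musGradient_apply, projDeriv_horizontalLift, connectionMap_horizontalLift]

theorem musGradient_horizontal_vertical (X Y : TangentSpace I p.1) :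
    musGradient I g f p (horizontalLift I g p X) (verticalLift I p Y) = 0 := by
  simp [musGradient_apply, projDeriv_verticalLift, connectionMap_horizontalLift]

theorem musGradient_vertical_vertical (X Y : TangentSpace I p.1) :
    musGradient I g f p (verticalLift I p X) (verticalLift I p Y) =
      g p.1 X Y + mvfderiv I f p.1 X * mvfderiv I f p.1 Y := by
  simp [musGradient_apply, projDeriv_verticalLift, connectionMap_verticalLift]

end TangentBundle

end Riem

end

set_option linter.unusedSectionVars false
set_option synthInstance.maxHeartbeats 200000

noncomputable section

namespace LocalRiem

/-! The projection `π` is a Riemannian submersion: `g^f` is `g` on horizontal vectors and `h = g +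
df ⊗ df` on vertical ones. Hence `∇dπ` vanishes on pairs of horizontal vectors. On vertical vectors
`a`, `b`, the Koszul formula tested against a horizontal `w` gives `g(∇dπ(a, b), w) = ½ (∇_w h)(a,
b)`, and `∇h = ∇(df ⊗ df)` because `∇g = 0`. The `h`-trace of this is `Hess f(w, h^♯ df)`, where
`h^♯ df = α⁻¹ grad f`. Therefore `τ(π) = ½ grad ln α` along `π` (`tension_fst`).

Whenever the tension field is a vector field `V` on the base, the second-order chain rule gives
`τ₂(π) = -Ricci V - Tr ∇²V - ∇_V V` (`bitension_fst`); the last term appears because `Tr ∇dπ` is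
again `V`. Take `V = ½ grad s` with `s = ln α`. The Weitzenböck formula `Tr ∇² grad s = grad Δs +
Ricci(grad s)` (`fderiv_laplacian`) and `∇_{grad s} grad s = ½ grad ‖grad s‖²`
(`fderiv_gradient_sq`) turn this, for an Einstein metric, into `τ₂(π) = -grad(λ s + ½ Δs + ⅛ ‖grad
s‖²)` (`apply_bitension_fst`). Biharmonicity thus says that the differential of this function
vanishes, which on a connected manifold means that the function is constant.

The computation takes place on open subsets of the model space. On `M` each quantity at a point is
read in the preferred chart of that point, so the transfer needs chart independence of `‖grad u‖²`
and `Δu` (`gradNormSq_eq`, `laplacian_eq`) and the expression of `g^f` in the induced charts of `TM`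
(`metricInChart_musGradient`). The last two rest on the transformation law of the Christoffel
symbols (`christoffel_pullback`). -/

theorem two_le_infty : (2 : WithTop ℕ∞) ≤ ∞ :=
  WithTop.coe_le_coe.2 (le_top : (2 : ℕ∞) ≤ ⊤)

/-! ### Metrics on open sets: traces, connection, curvature -/

section Local

variable {E : Type*} [NormedAddCommGroup E] [NormedSpace ℝ E]
  {F : Type*} [NormedAddCommGroup F] [NormedSpace ℝ F]

/-- `G` is a smooth Riemannian metric on the open set `U`. -/
structure IsMetricOn (G : E → E →L[ℝ] E →L[ℝ] ℝ) (U : Set E) : Prop where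
  isOpen : IsOpen U
  contDiffAt : ∀ z ∈ U, ContDiffAt ℝ ∞ G z
  symm : ∀ z ∈ U, ∀ v w, G z v w = G z w v
  pos : ∀ z ∈ U, ∀ v, v ≠ 0 → 0 < G z v v

/-- The product rule for a field of bilinear forms applied to two vector fields. -/
theorem fderiv_bilin {X : Type*} [NormedAddCommGroup X] [NormedSpace ℝ X]
    {E₁ E₂ : Type*} [NormedAddCommGroup E₁] [NormedSpace ℝ E₁]
    [NormedAddCommGroup E₂] [NormedSpace ℝ E₂]
    {B : X → E₁ →L[ℝ] E₂ →L[ℝ] F} {V : X → E₁} {W : X → E₂} {z : X} (hB : DifferentiableAt ℝ B z)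
    (hV : DifferentiableAt ℝ V z) (hW : DifferentiableAt ℝ W z) (a : X) :
    fderiv ℝ (fun y => B y (V y) (W y)) z a =
      fderiv ℝ B z a (V z) (W z) + B z (fderiv ℝ V z a) (W z) + B z (V z) (fderiv ℝ W z a) := by
  rw [((hB.hasFDerivAt.clm_apply hV.hasFDerivAt).clm_apply hW.hasFDerivAt).fderiv]
  simp
  abel

theorem fderiv_clm {X : Type*} [NormedAddCommGroup X] [NormedSpace ℝ X]
    {E₁ : Type*} [NormedAddCommGroup E₁] [NormedSpace ℝ E₁]
    {B : X → E₁ →L[ℝ] F} {V : X → E₁} {z : X} (hB : DifferentiableAt ℝ B z)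
    (hV : DifferentiableAt ℝ V z) (a : X) :
    fderiv ℝ (fun y => B y (V y)) z a = fderiv ℝ B z a (V z) + B z (fderiv ℝ V z a) := by
  rw [(hB.hasFDerivAt.clm_apply hV.hasFDerivAt).fderiv]
  simp
  abel

section Sharp

variable [FiniteDimensional ℝ E] {B : E →L[ℝ] E →L[ℝ] ℝ}

/-- Definiteness makes `B` injective, and a space and its dual have the same finite dimension. -/
theorem isInvertible_of_pos (hB : ∀ v, v ≠ 0 → 0 < B v v) : B.IsInvertible := by
  have hinj : Function.Injective B := by
    rw [injective_iff_map_eq_zero]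
    intro v hv
    by_contra h
    have := hB v h
    simp [hv] at this
  have hfin : Module.finrank ℝ E = Module.finrank ℝ (E →L[ℝ] ℝ) := by
    rw [← (LinearMap.toContinuousLinearMap (𝕜 := ℝ) (E := E) (F' := ℝ)).finrank_eq]
    exact (Subspace.dual_finrank_eq (K := ℝ) (V := E)).symm
  let e : E ≃L[ℝ] (E →L[ℝ] ℝ) :=
    (LinearEquiv.ofInjectiveOfFinrankEq (B : E →ₗ[ℝ] E →L[ℝ] ℝ) hinj hfin).toContinuousLinearEquiv
  exact ⟨e, by ext v w; rfl⟩

theorem apply_sharp (hB : B.IsInvertible) (ℓ : E →L[ℝ] ℝ) : B (sharp B ℓ) = ℓ :=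
  hB.self_apply_inverse ℓ

theorem sharp_apply (hB : B.IsInvertible) (v : E) : sharp B (B v) = v :=
  hB.inverse_apply_self v

theorem eq_of_forall_apply_eq (hB : B.IsInvertible) {v w : E} (h : ∀ u, B v u = B w u) : v = w := by
  rw [← sharp_apply hB v, ← sharp_apply hB w]
  congr 1
  ext u
  exact h u

theorem sharp_eq_iff (hB : B.IsInvertible) {ℓ : E →L[ℝ] ℝ} {w : E} :
    sharp B ℓ = w ↔ ∀ u, B w u = ℓ u := by
  constructor
  · rintro rfl u
    rw [apply_sharp hB]
  · intro h
    apply eq_of_forall_apply_eq hB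
    intro u
    rw [apply_sharp hB, h]

end Sharp

section Trace

variable [FiniteDimensional ℝ E] {B : E →L[ℝ] E →L[ℝ] ℝ}

/-- The covector of coordinate `i` in a basis. -/
def coordL {ι : Type*} (b : Module.Basis ι ℝ E) (i : ι) : E →L[ℝ] ℝ :=
  LinearMap.toContinuousLinearMap (b.coord i)

@[simp]
theorem coordL_apply {ι : Type*} (b : Module.Basis ι ℝ E) (i : ι) (v : E) :
    coordL b i v = b.repr v i := rfl

theorem sum_coordL_smul {ι : Type*} [Fintype ι] (b : Module.Basis ι ℝ E) (v : E) :
    ∑ i, coordL b i v • b i = v := b.sum_repr v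

theorem map_eq_sum {ι : Type*} [Fintype ι] (b : Module.Basis ι ℝ E) (L : E →L[ℝ] F) (v : E) :
    L v = ∑ i, coordL b i v • L (b i) := by
  conv_lhs => rw [← sum_coordL_smul b v]
  simp only [map_sum, map_smul]

theorem sum_apply_smul_coordL {ι : Type*} [Fintype ι] (b : Module.Basis ι ℝ E) (ℓ : E →L[ℝ] ℝ) :
    ∑ i, ℓ (b i) • coordL b i = ℓ := by
  ext v
  rw [map_eq_sum b ℓ v]
  simp [mul_comm]

theorem trace_eq_finBasis (B : E →L[ℝ] E →L[ℝ] ℝ) (A : E → E → F) :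
    trace B A = ∑ i, A (Module.finBasis ℝ E i) (sharp B (coordL (Module.finBasis ℝ E) i)) := rfl

/-- The trace does not depend on the basis. -/
theorem sum_basis_eq {ι κ : Type*} [Fintype ι] [Fintype κ] (b : Module.Basis ι ℝ E)
    (c : Module.Basis κ ℝ E) (S : (E →L[ℝ] ℝ) →L[ℝ] E) (A : E →L[ℝ] E →L[ℝ] F) :
    ∑ i, A (b i) (S (coordL b i)) = ∑ j, A (c j) (S (coordL c j)) := by
  calc ∑ i, A (b i) (S (coordL b i))
      = ∑ i, ∑ j, coordL c j (b i) • A (c j) (S (coordL b i)) := by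
        refine Finset.sum_congr rfl fun i _ => ?_
        exact map_eq_sum c (A.flip (S (coordL b i))) (b i)
    _ = ∑ j, A (c j) (S (∑ i, coordL c j (b i) • coordL b i)) := by
        rw [Finset.sum_comm]
        simp only [map_sum, map_smul]
    _ = _ := by simp only [sum_apply_smul_coordL]

theorem trace_eq_sum {ι : Type*} [Fintype ι] (b : Module.Basis ι ℝ E) (B : E →L[ℝ] E →L[ℝ] ℝ)
    (A : E →L[ℝ] E →L[ℝ] F) : trace B (fun v w => A v w) = ∑ i, A (b i) (sharp B (coordL b i)) := by
  rw [trace_eq_finBasis]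
  exact sum_basis_eq _ _ _ _

theorem trace_congr {A A' : E → E → F} (h : ∀ v w, A v w = A' v w) : trace B A = trace B A' := by
  have : A = A' := by ext v w; exact h v w
  rw [this]

theorem trace_add (A A' : E → E → F) :
    trace B (fun v w => A v w + A' v w) = trace B A + trace B A' := by
  simp [trace, Finset.sum_add_distrib]

theorem trace_sub (A A' : E → E → F) :
    trace B (fun v w => A v w - A' v w) = trace B A - trace B A' := by
  simp [trace, Finset.sum_sub_distrib]

theorem map_trace {F' : Type*} [NormedAddCommGroup F'] [NormedSpace ℝ F'] (L : F →L[ℝ] F')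
    (A : E → E → F) : L (trace B A) = trace B (fun v w => L (A v w)) := by
  simp [trace]

/-- The trace with respect to a symmetric form of a bilinear map and of its flip agree. -/
theorem trace_flip (hB : B.IsInvertible) (hs : ∀ v w, B v w = B w v) (A : E →L[ℝ] E →L[ℝ] F) :
    trace B (fun v w => A w v) = trace B (fun v w => A v w) := by
  set b := Module.finBasis ℝ E
  have hsym : ∀ i j, coordL b j (sharp B (coordL b i)) = coordL b i (sharp B (coordL b j)) := by
    intro i j
    conv_lhs => rw [← apply_sharp hB (coordL b j)]
    conv_rhs => rw [← apply_sharp hB (coordL b i)]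
    exact hs _ _
  calc ∑ i, A (sharp B (coordL b i)) (b i)
      = ∑ i, ∑ j, coordL b j (sharp B (coordL b i)) • A (b j) (b i) := by
        refine Finset.sum_congr rfl fun i _ => ?_
        exact map_eq_sum b (A.flip (b i)) (sharp B (coordL b i))
    _ = ∑ j, A (b j) (∑ i, coordL b i (sharp B (coordL b j)) • b i) := by
        rw [Finset.sum_comm]
        simp only [map_sum, map_smul, hsym]
    _ = _ := by simp only [sum_coordL_smul]; rfl

/-- The trace of `G(L v, w)` is the trace of the endomorphism `L`. -/
theorem trace_apply_eq (hB : B.IsInvertible) (hs : ∀ v w, B v w = B w v) (L : E →L[ℝ] E) :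
    trace B (fun v w => B (L v) w) = LinearMap.trace ℝ E (L : E →ₗ[ℝ] E) := by
  rw [LinearMap.trace_eq_matrix_trace ℝ (Module.finBasis ℝ E), Matrix.trace, trace_eq_finBasis]
  refine Finset.sum_congr rfl fun i _ => ?_
  rw [hs, apply_sharp hB]
  simp [LinearMap.toMatrix_apply]

end Trace

/-- The covariant derivative `X ↦ ∇_X V` of a vector field. -/
def covD (G : E → E →L[ℝ] E →L[ℝ] ℝ) (V : E → E) (z : E) : E →L[ℝ] E :=
  fderiv ℝ V z + (christoffel G z).flip (V z)

theorem covD_apply (G : E → E →L[ℝ] E →L[ℝ] ℝ) (V : E → E) (z a : E) :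
    covD G V z a = fderiv ℝ V z a + christoffel G z a (V z) := by
  simp [covD]

/-- The second covariant derivative `∇²V(X, Y) = ∇_X (∇V)(Y)` of a vector field. -/
def covD2 (G : E → E →L[ℝ] E →L[ℝ] ℝ) (V : E → E) (z : E) : E →L[ℝ] E →L[ℝ] E :=
  fderiv ℝ (covD G V) z + (ContinuousLinearMap.compL ℝ E E E).flip (covD G V z) ∘L christoffel G z
    - ContinuousLinearMap.compL ℝ E E E (covD G V z) ∘L christoffel G z

theorem covD2_apply (G : E → E →L[ℝ] E →L[ℝ] ℝ) (V : E → E) (z a b : E) :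
    covD2 G V z a b = fderiv ℝ (covD G V) z a b + christoffel G z a (covD G V z b)
      - covD G V z (christoffel G z a b) := by
  simp [covD2]

/-- The curvature as a trilinear map. -/
def curvatureL (G : E → E →L[ℝ] E →L[ℝ] ℝ) (z X : E) : E →L[ℝ] E →L[ℝ] E :=
  fderiv ℝ (christoffel G) z X - (fderiv ℝ (christoffel G) z).flip X
    + ContinuousLinearMap.compL ℝ E E E (christoffel G z X) ∘L christoffel G z
    - (ContinuousLinearMap.compL ℝ E E E).flip (christoffel G z X) ∘L christoffel G z

theorem curvatureL_apply (G : E → E →L[ℝ] E →L[ℝ] ℝ) (z X Y Z : E) :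
    curvatureL G z X Y Z = fderiv ℝ (christoffel G) z X Y Z - fderiv ℝ (christoffel G) z Y X Z
      + christoffel G z X (christoffel G z Y Z) - christoffel G z Y (christoffel G z X Z) := by
  simp [curvatureL]

/-- The gradient of a function. -/
def gradient (G : E → E →L[ℝ] E →L[ℝ] ℝ) (u : E → ℝ) (z : E) : E := sharp (G z) (fderiv ℝ u z)

/-- The Hessian `∇du` of a function. -/
def hessian (G : E → E →L[ℝ] E →L[ℝ] ℝ) (u : E → ℝ) (z : E) : E →L[ℝ] E →L[ℝ] ℝ :=
  fderiv ℝ (fderiv ℝ u) z - ContinuousLinearMap.compL ℝ E E ℝ (fderiv ℝ u z) ∘L christoffel G z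

theorem hessian_apply (G : E → E →L[ℝ] E →L[ℝ] ℝ) (u : E → ℝ) (z a b : E) :
    hessian G u z a b = fderiv ℝ (fderiv ℝ u) z a b - fderiv ℝ u z (christoffel G z a b) := by
  simp [hessian]

/-! ### Symmetries of the Levi-Civita connection and of its curvature -/

namespace IsMetricOn

variable [FiniteDimensional ℝ E] {G : E → E →L[ℝ] E →L[ℝ] ℝ} {U : Set E} {z : E}

theorem mem_nhds (hG : IsMetricOn G U) (hz : z ∈ U) : U ∈ nhds z := hG.isOpen.mem_nhds hz

theorem isInvertible (hG : IsMetricOn G U) (hz : z ∈ U) : (G z).IsInvertible :=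
  isInvertible_of_pos (hG.pos z hz)

theorem differentiableAt (hG : IsMetricOn G U) (hz : z ∈ U) : DifferentiableAt ℝ G z :=
  (hG.contDiffAt z hz).differentiableAt (by simp)

theorem contDiffAt_sharp (hG : IsMetricOn G U) (hz : z ∈ U) :
    ContDiffAt ℝ ∞ (fun y => sharp (G y)) z :=
  (hG.isInvertible hz).contDiffAt_map_inverse.comp z (hG.contDiffAt z hz)

theorem contDiffAt_christoffel (hG : IsMetricOn G U) (hz : z ∈ U) :
    ContDiffAt ℝ ∞ (christoffel G) z := by
  have h1 : ContDiffAt ℝ ∞ (fderiv ℝ G) z := (hG.contDiffAt z hz).fderiv_right (m := ∞) le_rfl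
  have h2 : ContDiffAt ℝ ∞ (fun y => (fderiv ℝ G y).flip) z :=
    (ContinuousLinearMap.flipₗᵢ ℝ E E (E →L[ℝ] ℝ)).toContinuousLinearEquiv.contDiff.contDiffAt.comp
      z h1
  refine ContDiffAt.clm_comp ?_ (((h1.add h2).sub (contDiffAt_const.clm_comp h2)).const_smul _)
  exact (ContinuousLinearMap.contDiff _).contDiffAt.comp z (hG.contDiffAt_sharp hz)

theorem differentiableAt_christoffel (hG : IsMetricOn G U) (hz : z ∈ U) :
    DifferentiableAt ℝ (christoffel G) z :=
  (hG.contDiffAt_christoffel hz).differentiableAt (by simp)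

theorem fderiv_symm (hG : IsMetricOn G U) (hz : z ∈ U) (u v w : E) :
    fderiv ℝ G z u v w = fderiv ℝ G z u w v := by
  have h1 := fderiv_bilin (hG.differentiableAt hz) (differentiableAt_const v)
    (differentiableAt_const w) u
  have h2 := fderiv_bilin (hG.differentiableAt hz) (differentiableAt_const w)
    (differentiableAt_const v) u
  have h : (fun y => G y v w) =ᶠ[nhds z] fun y => G y w v := by
    filter_upwards [hG.mem_nhds hz] with y hy using hG.symm y hy v w
  rw [h.fderiv_eq] at h1
  simpa using h1.symm.trans h2

theorem christoffel_symm (hG : IsMetricOn G U) (hz : z ∈ U) (v w : E) :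
    christoffel G z v w = christoffel G z w v := by
  rw [christoffel_apply, christoffel_apply]
  congr 2
  ext u
  simp [hG.fderiv_symm hz u v w, add_comm]

theorem two_mul_apply_christoffel (hG : IsMetricOn G U) (hz : z ∈ U) (v w u : E) :
    2 * G z (christoffel G z v w) u =
      fderiv ℝ G z v w u + fderiv ℝ G z w v u - fderiv ℝ G z u v w :=
  apply_christoffel G z v w u (hG.isInvertible hz)

/-- The Levi-Civita connection is compatible with the metric. -/
theorem fderiv_apply (hG : IsMetricOn G U) (hz : z ∈ U) (c a b : E) :
    fderiv ℝ G z c a b = G z (christoffel G z c a) b + G z a (christoffel G z c b) := by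
  have h1 := hG.two_mul_apply_christoffel hz c a b
  have h2 := hG.two_mul_apply_christoffel hz c b a
  rw [hG.symm z hz a]
  -- In the sum of the two Koszul formulas the derivatives along `a` and `b` cancel, leaving twice
  -- the derivative along `c`.
  have h3 := hG.fderiv_symm hz c a b
  have h4 := hG.fderiv_symm hz a c b
  have h5 := hG.fderiv_symm hz b c a
  linarith

/-- The trilinear form is the one to which basis-independent traces and flips apply. The vectors are
constant, so they pass through the derivative of the Christoffel symbols. -/
theorem curvature_eq (hG : IsMetricOn G U) (hz : z ∈ U) (X Y Z : E) :
    curvature G z X Y Z = curvatureL G z X Y Z := by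
  have h : ∀ X Y Z : E, fderiv ℝ (fun y => christoffel G y Y Z) z X
      = fderiv ℝ (christoffel G) z X Y Z := by
    intro X Y Z
    rw [fderiv_bilin (hG.differentiableAt_christoffel hz) (differentiableAt_const Y)
      (differentiableAt_const Z)]
    simp
  rw [curvature, h, h, curvatureL_apply]

theorem curvature_antisymm (X Y Z : E) : curvatureL G z X Y Z = - curvatureL G z Y X Z := by
  simp only [curvatureL_apply]
  abel

theorem fderiv_christoffel_symm (hG : IsMetricOn G U) (hz : z ∈ U) (X Y Z : E) :
    fderiv ℝ (christoffel G) z X Y Z = fderiv ℝ (christoffel G) z X Z Y := by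
  have h1 := fderiv_bilin (hG.differentiableAt_christoffel hz) (differentiableAt_const Y)
    (differentiableAt_const Z) X
  have h2 := fderiv_bilin (hG.differentiableAt_christoffel hz) (differentiableAt_const Z)
    (differentiableAt_const Y) X
  have h : (fun y => christoffel G y Y Z) =ᶠ[nhds z] fun y => christoffel G y Z Y := by
    filter_upwards [hG.mem_nhds hz] with y hy using hG.christoffel_symm hy Y Z
  rw [h.fderiv_eq] at h1
  simpa using h1.symm.trans h2

/-- The first Bianchi identity. -/
theorem bianchi (hG : IsMetricOn G U) (hz : z ∈ U) (X Y Z : E) :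
    curvatureL G z X Y Z + curvatureL G z Y Z X + curvatureL G z Z X Y = 0 := by
  simp only [curvatureL_apply]
  rw [hG.fderiv_christoffel_symm hz X Z Y, hG.fderiv_christoffel_symm hz Y X Z,
    hG.fderiv_christoffel_symm hz Z Y X, hG.christoffel_symm hz Z X, hG.christoffel_symm hz Z Y,
    hG.christoffel_symm hz Y X]
  abel

/-- The curvature endomorphisms are skew. -/
theorem apply_curvature_antisymm (hG : IsMetricOn G U) (hz : z ∈ U) (X Y Z W : E) :
    G z (curvatureL G z X Y Z) W = - G z (curvatureL G z X Y W) Z := by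
  have hΓ := hG.differentiableAt_christoffel hz
  have hGd := hG.differentiableAt hz
  -- Metric compatibility along `Y`, differentiated once more along `X`.
  have key : ∀ X Y Z W : E, fderiv ℝ (fderiv ℝ G) z X Y Z W =
      fderiv ℝ G z X (christoffel G z Y Z) W + G z (fderiv ℝ (christoffel G) z X Y Z) W
      + (fderiv ℝ G z X Z (christoffel G z Y W) + G z Z (fderiv ℝ (christoffel G) z X Y W)) := by
    intro X Y Z W
    have hc : ∀ Z : E, DifferentiableAt ℝ (fun y => christoffel G y Y Z) z := fun Z =>
      (hΓ.clm_apply (differentiableAt_const Y)).clm_apply (differentiableAt_const Z)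
    have e : (fun y => fderiv ℝ G y Y Z W) =ᶠ[nhds z] fun y =>
        G y (christoffel G y Y Z) W + G y Z (christoffel G y Y W) := by
      filter_upwards [hG.mem_nhds hz] with y hy using hG.fderiv_apply hy Y Z W
    have hd : DifferentiableAt ℝ (fderiv ℝ G) z :=
      ((hG.contDiffAt z hz).fderiv_right (m := ∞) le_rfl).differentiableAt (by simp)
    have l : fderiv ℝ (fun y => fderiv ℝ G y Y Z W) z X = fderiv ℝ (fderiv ℝ G) z X Y Z W := by
      rw [fderiv_bilin (B := fun y => fderiv ℝ G y Y) (hd.clm_apply (differentiableAt_const Y))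
        (differentiableAt_const Z) (differentiableAt_const W),
        fderiv_clm hd (differentiableAt_const Y)]
      simp
    have hcd : ∀ Z : E, fderiv ℝ (fun y => christoffel G y Y Z) z X =
        fderiv ℝ (christoffel G) z X Y Z := by
      intro Z
      rw [fderiv_bilin hΓ (differentiableAt_const Y) (differentiableAt_const Z)]
      simp
    rw [← l, e.fderiv_eq, fderiv_fun_add
      ((hGd.clm_apply (hc Z)).clm_apply (differentiableAt_const W))
      ((hGd.clm_apply (differentiableAt_const Z)).clm_apply (hc W)), add_apply,
      fderiv_bilin hGd (hc Z) (differentiableAt_const W),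
      fderiv_bilin hGd (differentiableAt_const Z) (hc W), hcd, hcd]
    simp
  -- Equality of mixed second derivatives of `G` is the source of skewness: antisymmetrising `key`
  -- in `X`, `Y` leaves exactly the two curvature terms.
  have hs : fderiv ℝ (fderiv ℝ G) z X Y = fderiv ℝ (fderiv ℝ G) z Y X :=
    ((hG.contDiffAt z hz).isSymmSndFDerivAt (by simpa using two_le_infty)).eq X Y
  have h := congrArg (fun B => B Z W) hs
  simp only [key, hG.fderiv_apply hz] at h
  simp only [curvatureL_apply, map_add, map_sub, add_apply,
    sub_apply]
  have hsy := hG.symm z hz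
  simp only [hsy _ Z] at h ⊢
  rw [hsy _ (christoffel G z X W), hsy _ (christoffel G z Y W)] at h
  linarith

/-- The pair symmetry of the curvature tensor. -/
theorem apply_curvature_pair (hG : IsMetricOn G U) (hz : z ∈ U) (X Y Z W : E) :
    G z (curvatureL G z X Y Z) W = G z (curvatureL G z Z W X) Y := by
  have b : ∀ X Y Z W, G z (curvatureL G z X Y Z) W + G z (curvatureL G z Y Z X) W
      + G z (curvatureL G z Z X Y) W = 0 := by
    intro X Y Z W
    have := congrArg (fun v => G z v W) (hG.bianchi hz X Y Z)
    simpa using this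
  have a1 : ∀ X Y Z W, G z (curvatureL G z X Y Z) W = - G z (curvatureL G z Y X Z) W := by
    intro X Y Z W
    rw [curvature_antisymm]; simp
  have a2 := hG.apply_curvature_antisymm hz
  -- The octahedron argument: the four cyclic Bianchi identities combine, and skewness in each pair
  -- cancels all but the two desired terms.
  have := b X Y Z W
  have := b Y Z W X
  have := b Z W X Y
  have := b W X Y Z
  have := a1 X Y Z W
  linarith [a2 X Y Z W, a2 Y Z X W, a2 Z X Y W, a2 Z W Y X, a2 W Y Z X, a2 Z W X Y, a2 W X Z Y,
    a2 X Z W Y, a2 W X Y Z, a2 X Y W Z, a2 Y W X Z, a1 X Y Z W, a1 Y Z X W, a1 Z X Y W, a1 Z W Y X,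
    a1 W Y Z X, a1 Z W X Y, a1 W X Z Y, a1 X Z W Y, a1 W X Y Z, a1 X Y W Z, a1 Y W X Z, a1 Y Z W X,
    a1 Z X W Y, a1 W Y X Z]

end IsMetricOn

end Local

end LocalRiem

namespace LocalRiem

/-! ### Second covariant derivatives and the Weitzenböck formula -/

section Weitzenbock

variable {E : Type*} [NormedAddCommGroup E] [NormedSpace ℝ E]
  {F : Type*} [NormedAddCommGroup F] [NormedSpace ℝ F]

namespace IsMetricOn

variable [FiniteDimensional ℝ E] {G : E → E →L[ℝ] E →L[ℝ] ℝ} {U : Set E} {z : E}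
  {u : E → ℝ} {V : E → E}

theorem contDiffAt_gradient (hG : IsMetricOn G U) (hz : z ∈ U) (hu : ContDiffAt ℝ ∞ u z) :
    ContDiffAt ℝ ∞ (gradient G u) z :=
  (hG.contDiffAt_sharp hz).clm_apply (hu.fderiv_right (m := ∞) le_rfl)

theorem contDiffAt_covD (hG : IsMetricOn G U) (hz : z ∈ U) (hV : ContDiffAt ℝ ∞ V z) :
    ContDiffAt ℝ ∞ (covD G V) z := by
  refine (hV.fderiv_right (m := ∞) le_rfl).add (ContDiffAt.clm_apply ?_ hV)
  exact (ContinuousLinearMap.flipₗᵢ ℝ E E E).toContinuousLinearEquiv.contDiff.contDiffAt.comp z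
    (hG.contDiffAt_christoffel hz)

theorem apply_gradient (hG : IsMetricOn G U) (hz : z ∈ U) (c : E) :
    G z (gradient G u z) c = fderiv ℝ u z c := by
  rw [gradient, apply_sharp (hG.isInvertible hz)]

/-- The covariant derivative of the gradient is the Hessian. -/
theorem apply_covD_gradient (hG : IsMetricOn G U) (hz : z ∈ U) (hu : ContDiffAt ℝ ∞ u z)
    (b c : E) : G z (covD G (gradient G u) z b) c = hessian G u z b c := by
  have hW := (hG.contDiffAt_gradient hz hu).differentiableAt (by simp)
  have h1 := fderiv_bilin (hG.differentiableAt hz) hW (differentiableAt_const c) b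
  have e : (fun y => G y (gradient G u y) c) =ᶠ[nhds z] fun y => fderiv ℝ u y c := by
    filter_upwards [hG.mem_nhds hz] with y hy using hG.apply_gradient hy c
  have hd : DifferentiableAt ℝ (fderiv ℝ u) z :=
    (hu.fderiv_right (m := ∞) le_rfl).differentiableAt (by simp)
  rw [e.fderiv_eq, fderiv_clm hd (differentiableAt_const c), hG.fderiv_apply hz,
    hG.apply_gradient hz] at h1
  simp only [fderiv_fun_const, Pi.zero_apply, zero_apply, map_zero, add_zero] at h1
  rw [covD_apply, hessian_apply, map_add, add_apply]
  linarith

theorem hessian_symm (hG : IsMetricOn G U) (hz : z ∈ U) (hu : ContDiffAt ℝ ∞ u z) (b c : E) :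
    hessian G u z b c = hessian G u z c b := by
  rw [hessian_apply, hessian_apply, hG.christoffel_symm hz b c,
    (hu.isSymmSndFDerivAt (by simpa using two_le_infty)).eq b c]

theorem fderiv_covD_apply (hG : IsMetricOn G U) (hz : z ∈ U) (hV : ContDiffAt ℝ ∞ V z) (a b : E) :
    fderiv ℝ (fun y => covD G V y b) z a = fderiv ℝ (covD G V) z a b := by
  rw [fderiv_clm ((hG.contDiffAt_covD hz hV).differentiableAt (by simp))
    (differentiableAt_const b)]
  simp

/-- If `∇V` is self-adjoint near a point, then so is `∇_a ∇V`. -/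
theorem apply_covD2_symm (hG : IsMetricOn G U) (hz : z ∈ U) (hV : ContDiffAt ℝ ∞ V z)
    (hs : ∀ y ∈ U, ∀ b c, G y (covD G V y b) c = G y (covD G V y c) b) (a b c : E) :
    G z (covD2 G V z a b) c = G z (covD2 G V z a c) b := by
  have hd := (hG.contDiffAt_covD hz hV).differentiableAt (by simp)
  have key : ∀ b c, fderiv ℝ (fun y => G y (covD G V y b) c) z a =
      G z (covD2 G V z a b) c + G z (covD G V z (christoffel G z a b)) c
        + G z (covD G V z b) (christoffel G z a c) := by
    intro b c
    rw [fderiv_bilin (hG.differentiableAt hz) (hd.clm_apply (differentiableAt_const b))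
      (differentiableAt_const c), hG.fderiv_covD_apply hz hV, hG.fderiv_apply hz]
    simp only [fderiv_fun_const, Pi.zero_apply, zero_apply, map_zero, add_zero, covD2_apply,
      map_add, map_sub, add_apply, sub_apply]
    ring
  have e : (fun y => G y (covD G V y b) c) =ᶠ[nhds z] fun y => G y (covD G V y c) b := by
    filter_upwards [hG.mem_nhds hz] with y hy using hs y hy b c
  have := e.fderiv_eq (𝕜 := ℝ)
  have h := congrArg (fun L => L a) this
  simp only [key] at h
  have h1 := hs z hz b (christoffel G z a c)
  have h2 := hs z hz c (christoffel G z a b)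
  linarith

/-- The Ricci identity `∇²_{a,b} V - ∇²_{b,a} V = R(a, b) V`. -/
theorem covD2_sub_covD2 (hG : IsMetricOn G U) (hz : z ∈ U) (hV : ContDiffAt ℝ ∞ V z) (a b : E) :
    covD2 G V z a b - covD2 G V z b a = curvatureL G z a b (V z) := by
  have hΓ := hG.differentiableAt_christoffel hz
  have hVd := hV.differentiableAt (by simp)
  have hd : DifferentiableAt ℝ (fderiv ℝ V) z :=
    (hV.fderiv_right (m := ∞) le_rfl).differentiableAt (by simp)
  -- After antisymmetrisation the second derivative of `V` drops out by symmetry, and the terms with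
  -- a first derivative of `V` cancel because the connection is torsion free.
  have key : ∀ a b, fderiv ℝ (covD G V) z a b = fderiv ℝ (fderiv ℝ V) z a b
      + fderiv ℝ (christoffel G) z a b (V z) + christoffel G z b (fderiv ℝ V z a) := by
    intro a b
    rw [← hG.fderiv_covD_apply hz hV]
    have e : (fun y => covD G V y b) = fun y => fderiv ℝ V y b + christoffel G y b (V y) := by
      ext y; exact covD_apply G V y b
    rw [e, fderiv_fun_add (hd.clm_apply (differentiableAt_const b))
      ((hΓ.clm_apply (differentiableAt_const b)).clm_apply hVd), add_apply,
      fderiv_clm hd (differentiableAt_const b),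
      fderiv_bilin hΓ (differentiableAt_const b) hVd]
    simp
    abel
  have hs := (hV.isSymmSndFDerivAt (by simpa using two_le_infty)).eq a b
  simp only [covD2_apply, key, hs, curvatureL_apply, covD_apply, map_add,
    hG.christoffel_symm hz b a]
  abel

theorem laplacian_eq_trace_hessian (hu : ContDiffAt ℝ ∞ u z) :
    laplacian G u z = trace (G z) fun a b => hessian G u z a b := by
  refine trace_congr fun a b => ?_
  rw [hessian_apply, fderiv_clm ((hu.fderiv_right (m := ∞) le_rfl).differentiableAt (by simp))
    (differentiableAt_const b)]
  simp

/-- Raising an index replaces the metric trace of the Hessian by the trace of the endomorphism `∇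
grad u`. The latter trace is a fixed linear functional, so it can be differentiated without
differentiating the inverse metric. -/
theorem laplacian_eq_trace_covD (hG : IsMetricOn G U) (hz : z ∈ U) (hu : ContDiffAt ℝ ∞ u z) :
    laplacian G u z = LinearMap.trace ℝ E (covD G (gradient G u) z : E →ₗ[ℝ] E) := by
  rw [laplacian_eq_trace_hessian hu,
    ← trace_apply_eq (hG.isInvertible hz) (hG.symm z hz) (covD G (gradient G u) z)]
  exact trace_congr fun a b => (hG.apply_covD_gradient hz hu a b).symm

/-- The covariant and the ordinary derivative of the endomorphism `∇V` along `c` differ by the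
commutator of `Γ(c, ·)` with `∇V`, whose trace is zero. -/
theorem fderiv_trace_covD (hG : IsMetricOn G U) (hz : z ∈ U) (hV : ContDiffAt ℝ ∞ V z) (c : E) :
    fderiv ℝ (fun y => LinearMap.trace ℝ E (covD G V y : E →ₗ[ℝ] E)) z c =
      LinearMap.trace ℝ E (covD2 G V z c : E →ₗ[ℝ] E) := by
  let T : (E →L[ℝ] E) →L[ℝ] ℝ := LinearMap.toContinuousLinearMap
    (LinearMap.trace ℝ E ∘ₗ ContinuousLinearMap.coeLM ℝ)
  have hd := (hG.contDiffAt_covD hz hV).differentiableAt (by simp)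
  have h1 : fderiv ℝ (fun y => T (covD G V y)) z c = T (fderiv ℝ (covD G V) z c) := by
    rw [fderiv_clm (differentiableAt_const T) hd]
    simp
  have h2 : covD2 G V z c = fderiv ℝ (covD G V) z c +
      (christoffel G z c * covD G V z - covD G V z * christoffel G z c) := by
    ext b
    simp [covD2_apply]
    abel
  have h3 : T (covD2 G V z c) = T (fderiv ℝ (covD G V) z c) := by
    rw [h2, map_add, map_sub]
    have : T (christoffel G z c * covD G V z) = T (covD G V z * christoffel G z c) :=
      LinearMap.trace_mul_comm ℝ (christoffel G z c : E →ₗ[ℝ] E) (covD G V z : E →ₗ[ℝ] E)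
    rw [this, sub_self, add_zero]
  exact h1.trans h3.symm

theorem contDiffAt_trace_covD (hG : IsMetricOn G U) (hz : z ∈ U) (hV : ContDiffAt ℝ ∞ V z) :
    ContDiffAt ℝ ∞ (fun y => LinearMap.trace ℝ E (covD G V y : E →ₗ[ℝ] E)) z := by
  let T : (E →L[ℝ] E) →L[ℝ] ℝ := LinearMap.toContinuousLinearMap
    (LinearMap.trace ℝ E ∘ₗ ContinuousLinearMap.coeLM ℝ)
  exact T.contDiff.contDiffAt.comp z (hG.contDiffAt_covD hz hV)

theorem laplacian_eventuallyEq (hG : IsMetricOn G U) (hz : z ∈ U)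
    (hu : ∀ y ∈ U, ContDiffAt ℝ ∞ u y) :
    laplacian G u =ᶠ[nhds z]
      fun y => LinearMap.trace ℝ E (covD G (gradient G u) y : E →ₗ[ℝ] E) := by
  filter_upwards [hG.mem_nhds hz] with y hy using hG.laplacian_eq_trace_covD hy (hu y hy)

theorem contDiffAt_laplacian (hG : IsMetricOn G U) (hz : z ∈ U)
    (hu : ∀ y ∈ U, ContDiffAt ℝ ∞ u y) : ContDiffAt ℝ ∞ (laplacian G u) z :=
  (hG.contDiffAt_trace_covD hz (hG.contDiffAt_gradient hz (hu z hz))).congr_of_eventuallyEq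
    (hG.laplacian_eventuallyEq hz hu)

theorem ricci_eq (hG : IsMetricOn G U) (hz : z ∈ U) (X : E) :
    ricci G z X = trace (G z) fun a b => curvatureL G z X a b :=
  trace_congr fun a b => hG.curvature_eq hz X a b

/-- The Weitzenböck formula `Tr ∇² grad u = grad Δu + Ricci (grad u)`. -/
theorem fderiv_laplacian (hG : IsMetricOn G U) (hz : z ∈ U) (hu : ∀ y ∈ U, ContDiffAt ℝ ∞ u y)
    (c : E) :
    fderiv ℝ (laplacian G u) z c =
      G z (trace (G z) fun a b => covD2 G (gradient G u) z a b) c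
        - G z (ricci G z (gradient G u z)) c := by
  set W := gradient G u with hWdef
  have hW : ContDiffAt ℝ ∞ W z := hG.contDiffAt_gradient hz (hu z hz)
  have hi := hG.isInvertible hz
  have hsy := hG.symm z hz
  have hs : ∀ y ∈ U, ∀ b c, G y (covD G W y b) c = G y (covD G W y c) b := by
    intro y hy b c
    rw [hG.apply_covD_gradient hy (hu y hy), hG.apply_covD_gradient hy (hu y hy),
      hG.hessian_symm hy (hu y hy)]
  rw [(hG.laplacian_eventuallyEq hz hu).fderiv_eq, hG.fderiv_trace_covD hz hW,
    ← trace_apply_eq hi hsy, hG.ricci_eq hz]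
  have e1 : ∀ X : E → E → E, G z (trace (G z) X) c = trace (G z) fun a b => G z (X a b) c :=
    fun X => map_trace ((G z).flip c) X
  rw [e1, e1]
  -- Once the two slots of the Ricci trace are exchanged, the integrands agree pointwise. Commuting
  -- `c` past `a` in `∇²W` costs a curvature term, self-adjointness of `∇_a ∇W` exchanges `b` and
  -- `c`, and pair symmetry with skewness identifies the curvature term.
  have e2 : (trace (G z) fun a b => G z (curvatureL G z (W z) a b) c) =
      trace (G z) fun a b => G z (curvatureL G z (W z) b a) c :=
    (trace_flip hi hsy
      (ContinuousLinearMap.compL ℝ E E ℝ ((G z).flip c) ∘L curvatureL G z (W z))).symm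
  rw [e2, ← trace_sub]
  refine trace_congr fun a b => ?_
  have h1 := congrArg (fun v => G z v b) (hG.covD2_sub_covD2 hz hW c a)
  simp only [map_sub, sub_apply] at h1
  have h2 := hG.apply_covD2_symm hz hW hs a c b
  have h3 := hG.apply_curvature_pair hz c a (W z) b
  have h4 := hG.apply_curvature_antisymm hz (W z) b c a
  linarith

/-- The formula `∇_{grad u} grad u = ½ grad |grad u|²`. -/
theorem fderiv_gradient_sq (hG : IsMetricOn G U) (hz : z ∈ U) (hu : ContDiffAt ℝ ∞ u z) (c : E) :
    fderiv ℝ (fun y => G y (gradient G u y) (gradient G u y)) z c =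
      2 * G z (covD G (gradient G u) z (gradient G u z)) c := by
  have hW := (hG.contDiffAt_gradient hz hu).differentiableAt (by simp)
  rw [fderiv_bilin (hG.differentiableAt hz) hW hW, hG.fderiv_apply hz,
    hG.apply_covD_gradient hz hu, hG.hessian_symm hz hu, ← hG.apply_covD_gradient hz hu,
    covD_apply, map_add, add_apply, hG.symm z hz (gradient G u z),
    hG.symm z hz (gradient G u z)]
  ring

theorem contDiffAt_gradient_sq (hG : IsMetricOn G U) (hz : z ∈ U) (hu : ContDiffAt ℝ ∞ u z) :
    ContDiffAt ℝ ∞ (fun y => G y (gradient G u y) (gradient G u y)) z :=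
  ((hG.contDiffAt z hz).clm_apply (hG.contDiffAt_gradient hz hu)).clm_apply
    (hG.contDiffAt_gradient hz hu)

end IsMetricOn

/-! ### Behaviour under isometric changes of coordinates -/

section Pullback

variable [FiniteDimensional ℝ E] {E' : Type*} [NormedAddCommGroup E'] [NormedSpace ℝ E']
  [FiniteDimensional ℝ E']
  {G : E → E →L[ℝ] E →L[ℝ] ℝ} {U : Set E} {z : E}
  {G' : E' → E' →L[ℝ] E' →L[ℝ] ℝ} {U' : Set E'} {ψ : E → E'}

theorem sharp_pullback {B : E →L[ℝ] E →L[ℝ] ℝ} {B' : E' →L[ℝ] E' →L[ℝ] ℝ} (L : E ≃L[ℝ] E')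
    (hB : B.IsInvertible) (hB' : B'.IsInvertible) (h : ∀ a b, B a b = B' (L a) (L b))
    (ℓ : E' →L[ℝ] ℝ) : L (sharp B (ℓ ∘L (L : E →L[ℝ] E'))) = sharp B' ℓ := by
  symm
  rw [sharp_eq_iff hB']
  intro u
  obtain ⟨u, rfl⟩ := L.surjective u
  rw [← h, apply_sharp hB]
  rfl

theorem trace_pullback {B : E →L[ℝ] E →L[ℝ] ℝ} {B' : E' →L[ℝ] E' →L[ℝ] ℝ} (L : E ≃L[ℝ] E')
    (hB : B.IsInvertible) (hB' : B'.IsInvertible) (h : ∀ a b, B a b = B' (L a) (L b))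
    (A : E' →L[ℝ] E' →L[ℝ] F) :
    trace B (fun a b => A (L a) (L b)) = trace B' fun a b => A a b := by
  rw [trace_eq_sum ((Module.finBasis ℝ E).map L.toLinearEquiv), trace_eq_finBasis]
  refine Finset.sum_congr rfl fun i _ => ?_
  rw [← sharp_pullback L hB hB' h]
  congr 3
  ext v
  simp

/-- The transformation law of the Christoffel symbols. -/
theorem christoffel_pullback (hG : IsMetricOn G U) (hz : z ∈ U) (hG' : IsMetricOn G' U')
    (hz' : ψ z ∈ U') (hψ : ContDiffAt ℝ ∞ ψ z) (hsurj : Function.Surjective (fderiv ℝ ψ z))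
    (h : ∀ᶠ y in nhds z, ∀ a b, G y a b = G' (ψ y) (fderiv ℝ ψ y a) (fderiv ℝ ψ y b)) (a b : E) :
    christoffel G' (ψ z) (fderiv ℝ ψ z a) (fderiv ℝ ψ z b) + fderiv ℝ (fderiv ℝ ψ) z a b =
      fderiv ℝ ψ z (christoffel G z a b) := by
  have hψd := hψ.differentiableAt (by simp)
  have hψ2 : DifferentiableAt ℝ (fderiv ℝ ψ) z :=
    (hψ.fderiv_right (m := ∞) le_rfl).differentiableAt (by simp)
  have hz0 := h.self_of_nhds
  have key : ∀ c a b, fderiv ℝ G z c a b =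
      fderiv ℝ G' (ψ z) (fderiv ℝ ψ z c) (fderiv ℝ ψ z a) (fderiv ℝ ψ z b)
      + G' (ψ z) (fderiv ℝ (fderiv ℝ ψ) z c a) (fderiv ℝ ψ z b)
      + G' (ψ z) (fderiv ℝ ψ z a) (fderiv ℝ (fderiv ℝ ψ) z c b) := by
    intro c a b
    have e : (fun y => G y a b) =ᶠ[nhds z]
        fun y => (G' ∘ ψ) y (fderiv ℝ ψ y a) (fderiv ℝ ψ y b) := by
      filter_upwards [h] with y hy using hy a b
    have h1 := fderiv_bilin (hG.differentiableAt hz) (differentiableAt_const a)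
      (differentiableAt_const b) c
    have hc : ∀ a, fderiv ℝ (fun y => fderiv ℝ ψ y a) z c = fderiv ℝ (fderiv ℝ ψ) z c a := by
      intro a
      rw [fderiv_clm hψ2 (differentiableAt_const a)]
      simp
    rw [e.fderiv_eq, fderiv_bilin ((hG'.differentiableAt hz').comp z hψd)
      (hψ2.clm_apply (differentiableAt_const a)) (hψ2.clm_apply (differentiableAt_const b)),
      fderiv_comp z (hG'.differentiableAt hz') hψd, hc, hc] at h1
    simp at h1
    linarith
  apply eq_of_forall_apply_eq (hG'.isInvertible hz')
  intro w
  obtain ⟨c, rfl⟩ := hsurj w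
  rw [← hz0, map_add, add_apply]
  have h1 := hG.two_mul_apply_christoffel hz a b c
  have h2 := hG'.two_mul_apply_christoffel hz' (fderiv ℝ ψ z a) (fderiv ℝ ψ z b) (fderiv ℝ ψ z c)
  rw [key, key, key] at h1
  -- Of the six terms of the Koszul formula containing second derivatives of `ψ`, four cancel and
  -- the other two add up to `2 G'(D²ψ(a, b), Dψ c)`.
  have hs := (hψ.isSymmSndFDerivAt (by simpa using two_le_infty)).eq
  rw [hs b a, hs c a, hs c b, hG'.symm _ hz' (fderiv ℝ ψ z a) (fderiv ℝ (fderiv ℝ ψ) z b c),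
    hG'.symm _ hz' (fderiv ℝ ψ z b) (fderiv ℝ (fderiv ℝ ψ) z a c)] at h1
  linarith

/-- Hessians are compatible with isometric changes of coordinates. -/
theorem hessian_pullback (hG : IsMetricOn G U) (hz : z ∈ U) (hG' : IsMetricOn G' U')
    (hz' : ψ z ∈ U') (hψ : ContDiffAt ℝ ∞ ψ z) (hsurj : Function.Surjective (fderiv ℝ ψ z))
    (h : ∀ᶠ y in nhds z, ∀ a b, G y a b = G' (ψ y) (fderiv ℝ ψ y a) (fderiv ℝ ψ y b))
    {u : E → ℝ} {u' : E' → ℝ} (hu' : ContDiffAt ℝ ∞ u' (ψ z)) (huu' : u =ᶠ[nhds z] u' ∘ ψ)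
    (a b : E) :
    hessian G u z a b = hessian G' u' (ψ z) (fderiv ℝ ψ z a) (fderiv ℝ ψ z b) := by
  have hψd := hψ.differentiableAt (by simp)
  have hψ2 : DifferentiableAt ℝ (fderiv ℝ ψ) z :=
    (hψ.fderiv_right (m := ∞) le_rfl).differentiableAt (by simp)
  have hu2 : DifferentiableAt ℝ (fderiv ℝ u') (ψ z) :=
    (hu'.fderiv_right (m := ∞) le_rfl).differentiableAt (by simp)
  have e : fderiv ℝ u =ᶠ[nhds z] fun y => fderiv ℝ u' (ψ y) ∘L fderiv ℝ ψ y := by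
    have h1 : ∀ᶠ y in nhds z, ContDiffAt ℝ 1 ψ y :=
      (hψ.of_le (by simp)).eventually (by simp)
    have h2 : ∀ᶠ y in nhds z, ContDiffAt ℝ 1 u' (ψ y) :=
      hψ.continuousAt.eventually ((hu'.of_le (by simp)).eventually (by simp))
    filter_upwards [huu'.eventuallyEq_nhds, h1, h2] with y hy h1 h2
    rw [hy.fderiv_eq, fderiv_comp y (h2.differentiableAt (by simp)) (h1.differentiableAt (by simp))]
  have e1 : fderiv ℝ u z = fderiv ℝ u' (ψ z) ∘L fderiv ℝ ψ z := e.self_of_nhds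
  have h1 := fderiv_clm (B := fun y => fderiv ℝ u' (ψ y)) (V := fun y => fderiv ℝ ψ y b)
    (hu2.comp z hψd) (hψ2.clm_apply (differentiableAt_const b)) a
  have h2 : fderiv ℝ (fun y => fderiv ℝ u' (ψ y)) z =
      fderiv ℝ (fderiv ℝ u') (ψ z) ∘L fderiv ℝ ψ z := fderiv_comp z hu2 hψd
  have h3 : fderiv ℝ (fderiv ℝ u) z a b = fderiv ℝ (fun y => fderiv ℝ u y b) z a := by
    have : DifferentiableAt ℝ (fderiv ℝ u) z :=
      (((hu'.comp z hψ).congr_of_eventuallyEq huu').fderiv_right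
        (m := ∞) le_rfl).differentiableAt (by simp)
    rw [fderiv_clm this (differentiableAt_const b)]
    simp
  have e2 : (fun y => fderiv ℝ u y b) =ᶠ[nhds z] fun y => fderiv ℝ u' (ψ y) (fderiv ℝ ψ y b) := by
    filter_upwards [e] with y hy
    rw [hy]; rfl
  -- The chain rule produces `du'(D²ψ(a, b))`, which the inhomogeneous term in the transformation
  -- law of the Christoffel symbols absorbs.
  rw [hessian_apply, hessian_apply, h3, e2.fderiv_eq, h1, h2, e1,
    fderiv_clm hψ2 (differentiableAt_const b), ContinuousLinearMap.comp_apply,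
    ContinuousLinearMap.comp_apply, ← christoffel_pullback hG hz hG' hz' hψ hsurj h a b]
  simp

/-- The Laplacian is compatible with isometric changes of coordinates. -/
theorem laplacian_pullback (hG : IsMetricOn G U) (hz : z ∈ U) (hG' : IsMetricOn G' U')
    (hz' : ψ z ∈ U') (hψ : ContDiffAt ℝ ∞ ψ z) (L : E ≃L[ℝ] E')
    (hL : (L : E →L[ℝ] E') = fderiv ℝ ψ z)
    (h : ∀ᶠ y in nhds z, ∀ a b, G y a b = G' (ψ y) (fderiv ℝ ψ y a) (fderiv ℝ ψ y b))
    {u : E → ℝ} {u' : E' → ℝ} (hu' : ContDiffAt ℝ ∞ u' (ψ z)) (huu' : u =ᶠ[nhds z] u' ∘ ψ) :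
    laplacian G u z = laplacian G' u' (ψ z) := by
  have hsurj : Function.Surjective (fderiv ℝ ψ z) := by
    rw [← hL]; exact L.surjective
  rw [IsMetricOn.laplacian_eq_trace_hessian hu',
    IsMetricOn.laplacian_eq_trace_hessian ((hu'.comp z hψ).congr_of_eventuallyEq huu'),
    ← trace_pullback L (hG.isInvertible hz) (hG'.isInvertible hz') _ (hessian G' u' (ψ z))]
  · refine trace_congr fun a b => ?_
    rw [hessian_pullback hG hz hG' hz' hψ hsurj h hu' huu', ← hL]
    rfl
  · intro a b
    rw [h.self_of_nhds, ← hL]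
    rfl

end Pullback

end Weitzenbock

end LocalRiem

namespace LocalRiem

/-! ### The Mus-Gradient metric in coordinates -/

section MusGradient

variable {E : Type*} [NormedAddCommGroup E] [NormedSpace ℝ E]
  {F : Type*} [NormedAddCommGroup F] [NormedSpace ℝ F]

/-- The fibre form `g + df ⊗ df` in coordinates. -/
def fibreMetric (G : E → E →L[ℝ] E →L[ℝ] ℝ) (f : E → ℝ) (x : E) : E →L[ℝ] E →L[ℝ] ℝ :=
  G x + (fderiv ℝ f x).smulRight (fderiv ℝ f x)

theorem fibreMetric_apply (G : E → E →L[ℝ] E →L[ℝ] ℝ) (f : E → ℝ) (x a b : E) :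
    fibreMetric G f x a b = G x a b + fderiv ℝ f x a * fderiv ℝ f x b := by
  simp [fibreMetric]

/-- The connection map `(a, b) ↦ b + Γ(a, u)` at `(x, u)` in coordinates. -/
def connMap (G : E → E →L[ℝ] E →L[ℝ] ℝ) (p : E × E) : E × E →L[ℝ] E :=
  ContinuousLinearMap.snd ℝ E E + (christoffel G p.1).flip p.2 ∘L ContinuousLinearMap.fst ℝ E E

theorem connMap_apply (G : E → E →L[ℝ] E →L[ℝ] ℝ) (p ξ : E × E) :
    connMap G p ξ = ξ.2 + christoffel G p.1 ξ.1 p.2 := by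
  simp [connMap]

/-- The Mus-Gradient metric in coordinates. -/
def musMetric (G : E → E →L[ℝ] E →L[ℝ] ℝ) (f : E → ℝ) (p : E × E) :
    E × E →L[ℝ] E × E →L[ℝ] ℝ :=
  (G p.1).bilinearComp (ContinuousLinearMap.fst ℝ E E) (ContinuousLinearMap.fst ℝ E E) +
    (fibreMetric G f p.1).bilinearComp (connMap G p) (connMap G p)

theorem musMetric_apply (G : E → E →L[ℝ] E →L[ℝ] ℝ) (f : E → ℝ) (p ξ η : E × E) :
    musMetric G f p ξ η = G p.1 ξ.1 η.1 +
      fibreMetric G f p.1 (connMap G p ξ) (connMap G p η) := rfl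

/-- The horizontal lift in coordinates. -/
def horLift (G : E → E →L[ℝ] E →L[ℝ] ℝ) (p : E × E) : E →L[ℝ] E × E :=
  (ContinuousLinearMap.id ℝ E).prod (-(christoffel G p.1).flip p.2)

theorem horLift_apply (G : E → E →L[ℝ] E →L[ℝ] ℝ) (p : E × E) (a : E) :
    horLift G p a = (a, -christoffel G p.1 a p.2) := rfl

@[simp]
theorem horLift_fst (G : E → E →L[ℝ] E →L[ℝ] ℝ) (p : E × E) (a : E) :
    (horLift G p a).1 = a := rfl

@[simp]
theorem connMap_horLift (G : E → E →L[ℝ] E →L[ℝ] ℝ) (p : E × E) (a : E) :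
    connMap G p (horLift G p a) = 0 := by
  simp [connMap_apply, horLift_apply]

@[simp]
theorem connMap_vertical (G : E → E →L[ℝ] E →L[ℝ] ℝ) (p : E × E) (a : E) :
    connMap G p (0, a) = a := by
  simp [connMap_apply]

/-- The splitting of the tangent space of `TM` in coordinates. -/
def splitEquiv (G : E → E →L[ℝ] E →L[ℝ] ℝ) (p : E × E) : (E × E) ≃L[ℝ] E × E :=
  ContinuousLinearEquiv.equivOfInverse
    ((ContinuousLinearMap.fst ℝ E E).prod
      (ContinuousLinearMap.snd ℝ E E - (christoffel G p.1).flip p.2 ∘L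
        ContinuousLinearMap.fst ℝ E E))
    ((ContinuousLinearMap.fst ℝ E E).prod (connMap G p))
    (fun ξ => by ext <;> simp [connMap_apply])
    (fun ξ => by ext <;> simp [connMap_apply])

theorem splitEquiv_apply (G : E → E →L[ℝ] E →L[ℝ] ℝ) (p ξ : E × E) :
    splitEquiv G p ξ = (ξ.1, ξ.2 - christoffel G p.1 ξ.1 p.2) := rfl

theorem splitEquiv_symm_apply (G : E → E →L[ℝ] E →L[ℝ] ℝ) (p ξ : E × E) :
    (splitEquiv G p).symm ξ = (ξ.1, connMap G p ξ) := rfl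

/-- The logarithm of `α = 1 + ‖grad f‖²` in coordinates. -/
def logAlpha (G : E → E →L[ℝ] E →L[ℝ] ℝ) (f : E → ℝ) (x : E) : ℝ :=
  Real.log (1 + G x (gradient G f x) (gradient G f x))

/-- The function whose differential is minus the bitension field of the projection, if the metric
`G` is Einstein with constant `lam`. -/
def potential [FiniteDimensional ℝ E] (lam : ℝ) (G : E → E →L[ℝ] E →L[ℝ] ℝ) (s : E → ℝ) (x : E) : ℝ :=
  lam * s x + 1 / 2 * laplacian G s x + 1 / 8 * G x (gradient G s x) (gradient G s x)

/-- Symmetry of `B` turns the second factor into the coordinates of `sharp B ℓ₂`, and the sum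
reassembles that vector under `ℓ₁`. -/
theorem trace_mul [FiniteDimensional ℝ E] {B : E →L[ℝ] E →L[ℝ] ℝ} (hB : B.IsInvertible)
    (hs : ∀ v w, B v w = B w v) (ℓ₁ ℓ₂ : E →L[ℝ] ℝ) :
    trace B (fun a b => ℓ₁ a * ℓ₂ b) = ℓ₁ (sharp B ℓ₂) := by
  rw [trace_eq_finBasis, map_eq_sum (Module.finBasis ℝ E) ℓ₁ (sharp B ℓ₂)]
  refine Finset.sum_congr rfl fun i _ => ?_
  have : ℓ₂ (sharp B (coordL (Module.finBasis ℝ E) i)) =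
      coordL (Module.finBasis ℝ E) i (sharp B ℓ₂) := by
    conv_lhs => rw [← apply_sharp hB ℓ₂]
    rw [hs, apply_sharp hB]
  rw [this, smul_eq_mul, mul_comm]

/-! ### Tension and bitension fields of the projection -/

namespace IsMetricOn

variable [FiniteDimensional ℝ E] {G : E → E →L[ℝ] E →L[ℝ] ℝ} {U : Set E} {f : E → ℝ}

theorem nonneg (hG : IsMetricOn G U) {x : E} (hx : x ∈ U) (v : E) : 0 ≤ G x v v := by
  by_cases h : v = 0
  · simp [h]
  · exact (hG.pos x hx v h).le

theorem fibreMetric (hG : IsMetricOn G U) (hf : ∀ x ∈ U, ContDiffAt ℝ ∞ f x) :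
    IsMetricOn (fibreMetric G f) U where
  isOpen := hG.isOpen
  contDiffAt x hx := by
    have h1 : ContDiffAt ℝ ∞ (fderiv ℝ f) x := (hf x hx).fderiv_right (m := ∞) le_rfl
    exact (hG.contDiffAt x hx).add (h1.smulRight h1)
  symm x hx v w := by
    rw [fibreMetric_apply, fibreMetric_apply, hG.symm x hx, mul_comm]
  pos x hx v hv := by
    rw [fibreMetric_apply]
    have := hG.pos x hx v hv
    nlinarith [mul_self_nonneg (fderiv ℝ f x v)]

theorem contDiffAt_connMap (hG : IsMetricOn G U) {p : E × E} (hp : p.1 ∈ U) :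
    ContDiffAt ℝ ∞ (connMap G) p := by
  refine contDiffAt_const.add (ContDiffAt.clm_comp (ContDiffAt.clm_apply ?_ contDiffAt_snd)
    contDiffAt_const)
  exact (ContinuousLinearMap.flipₗᵢ ℝ E E E).toContinuousLinearEquiv.contDiff.contDiffAt.comp p
    ((hG.contDiffAt_christoffel hp).comp p contDiffAt_fst)

theorem musMetric (hG : IsMetricOn G U) (hf : ∀ x ∈ U, ContDiffAt ℝ ∞ f x) :
    IsMetricOn (musMetric G f) (U ×ˢ Set.univ) where
  isOpen := hG.isOpen.prod isOpen_univ
  contDiffAt p hp := by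
    have hp1 : p.1 ∈ U := hp.1
    have hc := hG.contDiffAt_connMap hp1
    have hflip : ∀ {X Y : Type _} [NormedAddCommGroup X] [NormedSpace ℝ X] [NormedAddCommGroup Y]
        [NormedSpace ℝ Y] {B : E × E → X →L[ℝ] Y →L[ℝ] ℝ}, ContDiffAt ℝ ∞ B p →
        ContDiffAt ℝ ∞ (fun q => (B q).flip) p := by
      intro X Y _ _ _ _ B hB
      exact (ContinuousLinearMap.flipₗᵢ ℝ X Y ℝ).toContinuousLinearEquiv.contDiff.contDiffAt.comp
        p hB
    have h1 : ContDiffAt ℝ ∞ (fun q : E × E => G q.1) p :=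
      (hG.contDiffAt p.1 hp1).comp p contDiffAt_fst
    have h2 : ContDiffAt ℝ ∞ (fun q : E × E => LocalRiem.fibreMetric G f q.1) p :=
      ((hG.fibreMetric hf).contDiffAt p.1 hp1).comp p contDiffAt_fst
    exact (hflip ((hflip (h1.clm_comp contDiffAt_const)).clm_comp contDiffAt_const)).add
      (hflip ((hflip (h2.clm_comp hc)).clm_comp hc))
  symm p hp ξ η := by
    rw [musMetric_apply, musMetric_apply, hG.symm _ hp.1, (hG.fibreMetric hf).symm _ hp.1]
  pos p hp ξ hξ := by
    rw [musMetric_apply]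
    have h1 := hG.nonneg hp.1 ξ.1
    have h2 := (hG.fibreMetric hf).nonneg hp.1 (connMap G p ξ)
    by_cases h : ξ.1 = 0
    · have hc : connMap G p ξ ≠ 0 := by
        intro h0
        apply hξ
        rw [connMap_apply, h] at h0
        ext
        · exact h
        · simpa using h0
      have := (hG.fibreMetric hf).pos _ hp.1 _ hc
      linarith
    · have := hG.pos _ hp.1 _ h
      linarith

theorem musMetric_horLift (p ζ : E × E) (w : E) :
    LocalRiem.musMetric G f p ζ (horLift G p w) = G p.1 ζ.1 w := by
  simp [musMetric_apply]

/-- The trace with respect to the Mus-Gradient metric splits into a horizontal and a vertical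
part. -/
theorem trace_musMetric (hG : IsMetricOn G U) (hf : ∀ x ∈ U, ContDiffAt ℝ ∞ f x) {p : E × E}
    (hp : p.1 ∈ U) (A : E × E →L[ℝ] E × E →L[ℝ] F) :
    trace (LocalRiem.musMetric G f p) (fun ξ η => A ξ η) =
      trace (G p.1) (fun a b => A (horLift G p a) (horLift G p b)) +
        trace (LocalRiem.fibreMetric G f p.1) (fun a b => A (0, a) (0, b)) := by
  have hK := (hG.musMetric hf).isInvertible (z := p) ⟨hp, trivial⟩
  set b := Module.finBasis ℝ E
  -- In the basis of horizontal lifts and vertical vectors the metric is block diagonal, so raising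
  -- an index respects the splitting.
  rw [trace_eq_sum ((b.prod b).map (splitEquiv G p).toLinearEquiv), Fintype.sum_sum_type,
    trace_eq_finBasis, trace_eq_finBasis]
  congr 1
  · refine Finset.sum_congr rfl fun i _ => ?_
    have h1 : ((b.prod b).map (splitEquiv G p).toLinearEquiv) (Sum.inl i) = horLift G p (b i) := by
      simp [splitEquiv_apply, horLift_apply]
    have h2 : sharp (LocalRiem.musMetric G f p)
        (coordL ((b.prod b).map (splitEquiv G p).toLinearEquiv) (Sum.inl i)) =
        horLift G p (sharp (G p.1) (coordL b i)) := by
      rw [sharp_eq_iff hK]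
      intro u
      rw [(hG.musMetric hf).symm p ⟨hp, trivial⟩, musMetric_horLift, hG.symm _ hp,
        apply_sharp (hG.isInvertible hp)]
      simp [splitEquiv_symm_apply]
    rw [h1, h2]
  · refine Finset.sum_congr rfl fun i _ => ?_
    have h1 : ((b.prod b).map (splitEquiv G p).toLinearEquiv) (Sum.inr i) = (0, b i) := by
      simp [splitEquiv_apply]
    have h2 : sharp (LocalRiem.musMetric G f p)
        (coordL ((b.prod b).map (splitEquiv G p).toLinearEquiv) (Sum.inr i)) =
        (0, sharp (LocalRiem.fibreMetric G f p.1) (coordL b i)) := by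
      rw [sharp_eq_iff hK]
      intro u
      rw [musMetric_apply, connMap_vertical, apply_sharp ((hG.fibreMetric hf).isInvertible hp)]
      simp [splitEquiv_symm_apply]
    rw [h1, h2]

/-- The projection is a Riemannian submersion: vertical vectors contribute nothing to the trace of a
form pulled back from the base. -/
theorem trace_musMetric_fst (hG : IsMetricOn G U) (hf : ∀ x ∈ U, ContDiffAt ℝ ∞ f x) {p : E × E}
    (hp : p.1 ∈ U) (A : E →L[ℝ] E →L[ℝ] F) :
    trace (LocalRiem.musMetric G f p) (fun ξ η => A ξ.1 η.1) = trace (G p.1) fun a b => A a b := by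
  have := hG.trace_musMetric hf hp (A.bilinearComp (ContinuousLinearMap.fst ℝ E E)
    (ContinuousLinearMap.fst ℝ E E))
  simp only [ContinuousLinearMap.bilinearComp_apply, ContinuousLinearMap.coe_fst', horLift_fst,
    map_zero] at this
  rw [this]
  simp [trace]

theorem fderiv_musMetric (hG : IsMetricOn G U) (hf : ∀ x ∈ U, ContDiffAt ℝ ∞ f x) {p : E × E}
    (hp : p.1 ∈ U) (ζ ξ η : E × E) :
    fderiv ℝ (LocalRiem.musMetric G f) p ζ ξ η =
      fderiv ℝ G p.1 ζ.1 ξ.1 η.1 +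
        (fderiv ℝ (LocalRiem.fibreMetric G f) p.1 ζ.1 (connMap G p ξ) (connMap G p η)
        + LocalRiem.fibreMetric G f p.1
            (fderiv ℝ (christoffel G) p.1 ζ.1 ξ.1 p.2 + christoffel G p.1 ξ.1 ζ.2) (connMap G p η)
        + LocalRiem.fibreMetric G f p.1 (connMap G p ξ)
            (fderiv ℝ (christoffel G) p.1 ζ.1 η.1 p.2 + christoffel G p.1 η.1 ζ.2)) := by
  have hfst : DifferentiableAt ℝ (Prod.fst : E × E → E) p := differentiableAt_fst
  have hGd := hG.differentiableAt hp
  have hhd := (hG.fibreMetric hf).differentiableAt hp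
  have hΓd := hG.differentiableAt_christoffel hp
  have hcd := (hG.contDiffAt_connMap hp).differentiableAt (by simp)
  have hc : ∀ ξ, DifferentiableAt ℝ (fun q => connMap G q ξ) p :=
    fun ξ => hcd.clm_apply (differentiableAt_const ξ)
  have hcc : ∀ ξ : E × E, fderiv ℝ (fun q => connMap G q ξ) p ζ =
      fderiv ℝ (christoffel G) p.1 ζ.1 ξ.1 p.2 + christoffel G p.1 ξ.1 ζ.2 := by
    intro ξ
    have e : (fun q => connMap G q ξ) =
        fun q : E × E => ξ.2 + (christoffel G ∘ Prod.fst) q ξ.1 q.2 := by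
      ext q; rw [connMap_apply]; rfl
    rw [e, fderiv_const_add, fderiv_bilin (hΓd.comp p hfst) (differentiableAt_const _)
      differentiableAt_snd, fderiv_comp p hΓd hfst, fderiv_fst, fderiv_snd]
    simp
  have h0 := fderiv_bilin ((hG.musMetric hf).differentiableAt (z := p) ⟨hp, trivial⟩)
    (differentiableAt_const ξ) (differentiableAt_const η) ζ
  have e : (fun q => LocalRiem.musMetric G f q ξ η) = fun q =>
      (G ∘ Prod.fst) q ξ.1 η.1 +
        (LocalRiem.fibreMetric G f ∘ Prod.fst) q (connMap G q ξ) (connMap G q η) := by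
    ext q; rw [musMetric_apply]; rfl
  have hd1 : DifferentiableAt ℝ (fun q : E × E => (G ∘ Prod.fst) q ξ.1 η.1) p :=
    ((hGd.comp p hfst).clm_apply (differentiableAt_const _)).clm_apply (differentiableAt_const _)
  have hd2 : DifferentiableAt ℝ (fun q : E × E =>
      (LocalRiem.fibreMetric G f ∘ Prod.fst) q (connMap G q ξ) (connMap G q η)) p :=
    ((hhd.comp p hfst).clm_apply (hc ξ)).clm_apply (hc η)
  rw [e, fderiv_fun_add hd1 hd2, add_apply, fderiv_bilin (hGd.comp p hfst)
    (differentiableAt_const _) (differentiableAt_const _), fderiv_bilin (hhd.comp p hfst) (hc ξ)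
    (hc η), hcc, hcc, fderiv_comp p hGd hfst, fderiv_comp p hhd hfst, fderiv_fst] at h0
  simp only [fderiv_fun_const, Pi.zero_apply, zero_apply, map_zero, add_zero,
    ContinuousLinearMap.comp_apply, ContinuousLinearMap.coe_fst', Function.comp_apply] at h0
  exact h0.symm

/-- Pairing with a horizontal `w` detects the base component. The connection map kills all three
vectors, so every fibre term of the Koszul formula vanishes and the formula for `G` remains. -/
theorem fst_christoffel_musMetric_horizontal (hG : IsMetricOn G U)
    (hf : ∀ x ∈ U, ContDiffAt ℝ ∞ f x) {p : E × E} (hp : p.1 ∈ U) (a b : E) :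
    (christoffel (LocalRiem.musMetric G f) p (horLift G p a) (horLift G p b)).1 =
      christoffel G p.1 a b := by
  apply eq_of_forall_apply_eq (hG.isInvertible hp)
  intro w
  have h := (hG.musMetric hf).two_mul_apply_christoffel (z := p) ⟨hp, trivial⟩
    (horLift G p a) (horLift G p b) (horLift G p w)
  simp only [musMetric_horLift, hG.fderiv_musMetric hf hp, connMap_horLift, horLift_fst, map_zero,
    zero_apply, add_zero] at h
  linarith [hG.two_mul_apply_christoffel hp a b w]

theorem fderiv_fibreMetric (hG : IsMetricOn G U) (hf : ∀ x ∈ U, ContDiffAt ℝ ∞ f x) {x : E}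
    (hx : x ∈ U) (w a b : E) :
    fderiv ℝ (LocalRiem.fibreMetric G f) x w a b = fderiv ℝ G x w a b +
      (fderiv ℝ (fderiv ℝ f) x w a * fderiv ℝ f x b +
        fderiv ℝ f x a * fderiv ℝ (fderiv ℝ f) x w b) := by
  have hd : DifferentiableAt ℝ (fderiv ℝ f) x :=
    ((hf x hx).fderiv_right (m := ∞) le_rfl).differentiableAt (by simp)
  have hda : ∀ a, DifferentiableAt ℝ (fun y => fderiv ℝ f y a) x :=
    fun a => hd.clm_apply (differentiableAt_const a)
  have hdc : ∀ a, fderiv ℝ (fun y => fderiv ℝ f y a) x w = fderiv ℝ (fderiv ℝ f) x w a := by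
    intro a
    rw [fderiv_clm hd (differentiableAt_const a)]
    simp
  have h0 := fderiv_bilin ((hG.fibreMetric hf).differentiableAt hx)
    (differentiableAt_const a) (differentiableAt_const b) w
  have e : (fun y => LocalRiem.fibreMetric G f y a b) =
      fun y => G y a b + fderiv ℝ f y a * fderiv ℝ f y b := by
    ext y; rw [fibreMetric_apply]
  rw [e, fderiv_fun_add (((hG.differentiableAt hx).clm_apply
    (differentiableAt_const a)).clm_apply (differentiableAt_const b)) ((hda a).fun_mul (hda b)),
    add_apply, fderiv_bilin (hG.differentiableAt hx) (differentiableAt_const a)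
    (differentiableAt_const b), fderiv_fun_mul (hda a) (hda b)] at h0
  simp [hdc] at h0
  linarith

/-- The Koszul formula gives `h(Γ(w, a), b) + h(a, Γ(w, b)) - ∂_w h(a, b)`, with `h` the fibre form.
This is `-(∇_w h)(a, b)`, and only the part `df ⊗ df` of `h` is not parallel. -/
theorem fst_christoffel_musMetric_vertical (hG : IsMetricOn G U)
    (hf : ∀ x ∈ U, ContDiffAt ℝ ∞ f x) {p : E × E} (hp : p.1 ∈ U) (a b w : E) :
    2 * G p.1 (christoffel (LocalRiem.musMetric G f) p (0, a) (0, b)).1 w =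
      -(hessian G f p.1 w a * fderiv ℝ f p.1 b + hessian G f p.1 w b * fderiv ℝ f p.1 a) := by
  have h := (hG.musMetric hf).two_mul_apply_christoffel (z := p) ⟨hp, trivial⟩
    (0, a) (0, b) (horLift G p w)
  simp only [musMetric_horLift, hG.fderiv_musMetric hf hp, connMap_horLift, connMap_vertical,
    horLift_fst, map_zero, zero_apply, add_zero, zero_add, hG.fderiv_fibreMetric hf hp,
    hG.fderiv_apply hp, fibreMetric_apply] at h
  rw [h, hessian_apply, hessian_apply, hG.symm _ hp b]
  ring

theorem one_add_pos (hG : IsMetricOn G U) {x : E} (hx : x ∈ U) :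
    0 < 1 + G x (gradient G f x) (gradient G f x) := by
  linarith [hG.nonneg hx (gradient G f x)]

/-- For the rank-one perturbation `h = g + df ⊗ df`, one has `h(grad f, ·) = (1 + ‖grad f‖²) df`. -/
theorem sharp_fibreMetric (hG : IsMetricOn G U) (hf : ∀ x ∈ U, ContDiffAt ℝ ∞ f x) {x : E}
    (hx : x ∈ U) :
    sharp (LocalRiem.fibreMetric G f x) (fderiv ℝ f x) =
      (1 + G x (gradient G f x) (gradient G f x))⁻¹ • gradient G f x := by
  rw [sharp_eq_iff ((hG.fibreMetric hf).isInvertible hx)]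
  intro u
  have h := (hG.one_add_pos (f := f) hx).ne'
  rw [fibreMetric_apply]
  simp only [map_smul, smul_apply, smul_eq_mul]
  rw [hG.apply_gradient hx] at h ⊢
  rw [hG.apply_gradient hx]
  field_simp

theorem contDiffAt_logAlpha (hG : IsMetricOn G U) (hf : ∀ x ∈ U, ContDiffAt ℝ ∞ f x) {x : E}
    (hx : x ∈ U) : ContDiffAt ℝ ∞ (logAlpha G f) x :=
  (contDiffAt_const.add (hG.contDiffAt_gradient_sq hx (hf x hx))).log (hG.one_add_pos hx).ne'

theorem fderiv_logAlpha (hG : IsMetricOn G U) (hf : ∀ x ∈ U, ContDiffAt ℝ ∞ f x) {x : E}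
    (hx : x ∈ U) (w : E) :
    fderiv ℝ (logAlpha G f) x w = 2 * hessian G f x w
      (sharp (LocalRiem.fibreMetric G f x) (fderiv ℝ f x)) := by
  have hd := (hG.contDiffAt_gradient_sq hx (hf x hx)).differentiableAt (by simp)
  have h := (hd.hasFDerivAt.const_add 1).log (hG.one_add_pos hx).ne'
  have h' : fderiv ℝ (logAlpha G f) x = _ := h.fderiv
  rw [h', smul_apply, hG.fderiv_gradient_sq hx (hf x hx),
    hG.apply_covD_gradient hx (hf x hx), hG.sharp_fibreMetric hf hx,
    hG.hessian_symm hx (hf x hx)]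
  simp only [map_smul, smul_eq_mul]
  ring

/-- The integrand of the tension field of the projection. -/
theorem tension_fst_eq (p : E × E) :
    tension (LocalRiem.musMetric G f) G Prod.fst p = trace (LocalRiem.musMetric G f p)
      fun ξ η => christoffel G p.1 ξ.1 η.1 - (christoffel (LocalRiem.musMetric G f) p ξ η).1 := by
  refine trace_congr fun ξ η => ?_
  simp [covAlong, fderiv_fst]

/-- The tension field of the projection is `½ grad ln α`. -/
theorem tension_fst (hG : IsMetricOn G U) (hf : ∀ x ∈ U, ContDiffAt ℝ ∞ f x) {p : E × E}
    (hp : p.1 ∈ U) :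
    tension (LocalRiem.musMetric G f) G Prod.fst p =
      (1 / 2 : ℝ) • gradient G (logAlpha G f) p.1 := by
  have hh := hG.fibreMetric hf
  rw [tension_fst_eq]
  have h1 := hG.trace_musMetric hf hp ((christoffel G p.1).bilinearComp
    (ContinuousLinearMap.fst ℝ E E) (ContinuousLinearMap.fst ℝ E E) -
    ContinuousLinearMap.compL ℝ (E × E) (E × E) E (ContinuousLinearMap.fst ℝ E E) ∘L
      christoffel (LocalRiem.musMetric G f) p)
  simp only [sub_apply, ContinuousLinearMap.bilinearComp_apply, ContinuousLinearMap.coe_fst',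
    ContinuousLinearMap.comp_apply, ContinuousLinearMap.compL_apply, horLift_fst,
    hG.fst_christoffel_musMetric_horizontal hf hp, sub_self, map_zero, zero_sub] at h1
  rw [h1]
  have h2 : trace (G p.1) (fun _ _ : E => (0 : E)) = 0 := by simp [trace]
  rw [h2, zero_add]
  apply eq_of_forall_apply_eq (hG.isInvertible hp)
  intro w
  rw [map_smul, smul_apply, hG.apply_gradient hp, hG.fderiv_logAlpha hf hp]
  have h3 := map_trace (B := LocalRiem.fibreMetric G f p.1) ((G p.1).flip w)
    (fun a b => -(christoffel (LocalRiem.musMetric G f) p (0, a) (0, b)).1)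
  have h4 : trace (LocalRiem.fibreMetric G f p.1) (fun a b => (G p.1).flip w
      (-(christoffel (LocalRiem.musMetric G f) p (0, a) (0, b)).1)) =
      trace (LocalRiem.fibreMetric G f p.1) fun a b =>
        (((1 / 2 : ℝ) • hessian G f p.1 w) a * fderiv ℝ f p.1 b +
          fderiv ℝ f p.1 a * ((1 / 2 : ℝ) • hessian G f p.1 w) b) := by
    refine trace_congr fun a b => ?_
    have := hG.fst_christoffel_musMetric_vertical hf hp a b w
    simp only [ContinuousLinearMap.flip_apply, map_neg,
      smul_apply, smul_eq_mul]
    linarith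
  -- Symmetry of the inverse fibre form makes the two halves of the trace equal, so together they
  -- give `Hess f(w, h^♯ df)`, half the differential of `ln α`.
  have h5 : fderiv ℝ f p.1 (sharp (LocalRiem.fibreMetric G f p.1)
      ((1 / 2 : ℝ) • hessian G f p.1 w)) = ((1 / 2 : ℝ) • hessian G f p.1 w)
        (sharp (LocalRiem.fibreMetric G f p.1) (fderiv ℝ f p.1)) := by
    have hi := hh.isInvertible hp
    conv_lhs => rw [← apply_sharp hi (fderiv ℝ f p.1)]
    rw [hh.symm _ hp, apply_sharp hi]
  rw [ContinuousLinearMap.flip_apply] at h3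
  rw [h3, h4, trace_add, trace_mul (hh.isInvertible hp) (hh.symm _ hp),
    trace_mul (hh.isInvertible hp) (hh.symm _ hp), h5]
  simp
  ring

/-- The bitension field of the projection, if its tension field is the vector field `V`. -/
theorem bitension_fst (hG : IsMetricOn G U) (hf : ∀ x ∈ U, ContDiffAt ℝ ∞ f x) {V : E → E}
    (hV : ∀ x ∈ U, ContDiffAt ℝ ∞ V x)
    (hτ : ∀ q : E × E, q.1 ∈ U → tension (LocalRiem.musMetric G f) G Prod.fst q = V q.1)
    {p : E × E} (hp : p.1 ∈ U) :
    bitension (LocalRiem.musMetric G f) G Prod.fst p =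
      -ricci G p.1 (V p.1) - (trace (G p.1) (fun a b => covD2 G V p.1 a b)
        + covD G V p.1 (V p.1)) := by
  have hU : ∀ q : E × E, q.1 ∈ U → (U ×ˢ Set.univ : Set (E × E)) ∈ nhds q := fun q hq =>
    (hG.musMetric hf).mem_nhds ⟨hq, trivial⟩
  have hcov : ∀ q : E × E, q.1 ∈ U → ∀ η, covAlong G Prod.fst
      (tension (LocalRiem.musMetric G f) G Prod.fst) q η = covD G V q.1 η.1 := by
    intro q hq η
    have e : tension (LocalRiem.musMetric G f) G Prod.fst =ᶠ[nhds q] V ∘ Prod.fst := by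
      filter_upwards [hU q hq] with r hr using hτ r hr.1
    rw [covAlong, e.fderiv_eq, hτ q hq, covD_apply,
      fderiv_comp q ((hV _ hq).differentiableAt (by simp)) differentiableAt_fst, fderiv_fst]
    rfl
  -- Second-order chain rule for `V ∘ π`: `∇²V(dπ ξ, dπ η)` plus `∇V` applied to `∇dπ(ξ, η)`. The
  -- trace of the second term is `∇V` at the tension field, which is `V` itself.
  have hcov2 : ∀ ξ η, covAlong G Prod.fst (fun q => covAlong G Prod.fst
      (tension (LocalRiem.musMetric G f) G Prod.fst) q η) p ξ - covAlong G Prod.fst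
      (tension (LocalRiem.musMetric G f) G Prod.fst) p
        (christoffel (LocalRiem.musMetric G f) p ξ η) =
      covD2 G V p.1 ξ.1 η.1 + covD G V p.1 (christoffel G p.1 ξ.1 η.1 -
        (christoffel (LocalRiem.musMetric G f) p ξ η).1) := by
    intro ξ η
    have e : (fun q => covAlong G Prod.fst
        (tension (LocalRiem.musMetric G f) G Prod.fst) q η) =ᶠ[nhds p]
        (fun x => covD G V x η.1) ∘ Prod.fst := by
      filter_upwards [hU p hp] with r hr using hcov r hr.1 η
    have hd := (hG.contDiffAt_covD hp (hV _ hp)).differentiableAt (by simp)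
    rw [covAlong, e.fderiv_eq, hcov p hp, hcov p hp, fderiv_comp p
      (hd.clm_apply (differentiableAt_const _)) differentiableAt_fst, fderiv_fst]
    simp only [ContinuousLinearMap.comp_apply, ContinuousLinearMap.coe_fst',
      hG.fderiv_covD_apply hp (hV _ hp), covD2_apply, map_sub]
    abel
  rw [bitension, jacobi, trace_congr hcov2, trace_add,
    hG.trace_musMetric_fst hf hp (covD2 G V p.1), ← map_trace, ← tension_fst_eq, hτ p hp]
  have h1 : trace (LocalRiem.musMetric G f p) (fun ξ η => curvature G p.1
      (V p.1) (fderiv ℝ Prod.fst p ξ) (fderiv ℝ Prod.fst p η)) = ricci G p.1 (V p.1) := by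
    rw [hG.ricci_eq hp, ← hG.trace_musMetric_fst hf hp (curvatureL G p.1 (V p.1))]
    refine trace_congr fun ξ η => ?_
    rw [hG.curvature_eq hp, fderiv_fst]
    rfl
  rw [h1]

theorem covD_smul {V : E → E} {x : E} (c : ℝ) (hV : DifferentiableAt ℝ V x) :
    covD G (fun y => c • V y) x = c • covD G V x := by
  ext a
  rw [covD_apply, fderiv_fun_const_smul hV, smul_apply,
    smul_apply, covD_apply, map_smul, smul_add]

theorem covD2_smul (hG : IsMetricOn G U) {V : E → E} {x : E} (hx : x ∈ U) (c : ℝ)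
    (hV : ∀ y ∈ U, ContDiffAt ℝ ∞ V y) :
    covD2 G (fun y => c • V y) x = c • covD2 G V x := by
  have e : covD G (fun y => c • V y) =ᶠ[nhds x] fun y => c • covD G V y := by
    filter_upwards [hG.mem_nhds hx] with y hy
    exact covD_smul c ((hV y hy).differentiableAt (by simp))
  ext a b
  rw [covD2_apply, e.fderiv_eq, e.self_of_nhds, fderiv_fun_const_smul
    ((hG.contDiffAt_covD hx (hV x hx)).differentiableAt (by simp))]
  simp only [smul_apply, covD2_apply, map_smul, smul_add, smul_sub]

theorem contDiffAt_potential (hG : IsMetricOn G U) {s : E → ℝ} (hs : ∀ x ∈ U, ContDiffAt ℝ ∞ s x)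
    {x : E} (hx : x ∈ U) (lam : ℝ) : ContDiffAt ℝ ∞ (potential lam G s) x :=
  ((contDiffAt_const.mul (hs x hx)).add (contDiffAt_const.mul (hG.contDiffAt_laplacian hx hs))).add
    (contDiffAt_const.mul (hG.contDiffAt_gradient_sq hx (hs x hx)))

/-- With `V = ½ grad s`, the Ricci term of the bitension field and the one from the Weitzenböck
formula each give `½ λ grad s`. The term `∇_V V = ¼ ∇_{grad s} grad s` accounts for the coefficient
`1/8`. -/
theorem apply_bitension_fst (hG : IsMetricOn G U) (hf : ∀ x ∈ U, ContDiffAt ℝ ∞ f x) {lam : ℝ}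
    {p : E × E} (hp : p.1 ∈ U) (hE : ∀ X, ricci G p.1 X = lam • X) (c : E) :
    G p.1 (bitension (LocalRiem.musMetric G f) G Prod.fst p) c =
      -fderiv ℝ (potential lam G (logAlpha G f)) p.1 c := by
  set s := logAlpha G f with hs
  have hsd : ∀ x ∈ U, ContDiffAt ℝ ∞ s x := fun x hx => hG.contDiffAt_logAlpha hf hx
  have hWd : ∀ x ∈ U, ContDiffAt ℝ ∞ (gradient G s) x := fun x hx =>
    hG.contDiffAt_gradient hx (hsd x hx)
  have h1 := (hsd p.1 hp).differentiableAt (by simp)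
  have h2 := (hG.contDiffAt_laplacian hp hsd).differentiableAt (by simp)
  have h3 := (hG.contDiffAt_gradient_sq hp (hsd p.1 hp)).differentiableAt (by simp)
  have hpot : fderiv ℝ (potential lam G s) p.1 c = lam * fderiv ℝ s p.1 c
      + 1 / 2 * fderiv ℝ (laplacian G s) p.1 c
      + 1 / 8 * fderiv ℝ (fun y => G y (gradient G s y) (gradient G s y)) p.1 c := by
    have := ((h1.hasFDerivAt.const_mul lam).add (h2.hasFDerivAt.const_mul (1 / 2))).add
      (h3.hasFDerivAt.const_mul (1 / 8))
    have h' : fderiv ℝ (potential lam G s) p.1 = _ := this.fderiv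
    rw [h']
    simp
  rw [hpot, hG.fderiv_laplacian hp hsd, hG.fderiv_gradient_sq hp (hsd _ hp),
    hG.bitension_fst hf (V := fun y => (1 / 2 : ℝ) • gradient G s y)
      (fun x hx => (hWd x hx).const_smul _) (fun q hq => hG.tension_fst hf hq) hp, hE, hE,
    covD_smul _ ((hWd _ hp).differentiableAt (by simp)), hG.covD2_smul hp _ hWd,
    ← hG.apply_gradient hp (u := s)]
  have h4 : trace (G p.1) (fun a b => ((1 / 2 : ℝ) • covD2 G (gradient G s) p.1) a b) =
      (1 / 2 : ℝ) • trace (G p.1) fun a b => covD2 G (gradient G s) p.1 a b := by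
    simp [trace, Finset.smul_sum]
  rw [h4]
  simp only [map_sub, map_add, map_neg, map_smul, sub_apply, add_apply, neg_apply,
    smul_apply, smul_eq_mul]
  ring

end IsMetricOn

end MusGradient

end LocalRiem

namespace Riem

open LocalRiem Filter

/-! ### Changes of charts and components of the metric -/

section Charts

variable {E : Type*} [NormedAddCommGroup E] [NormedSpace ℝ E]
  {H : Type*} [TopologicalSpace H] (I : ModelWithCorners ℝ E H) [I.Boundaryless]
  {M : Type*} [TopologicalSpace M] [ChartedSpace H M] [IsManifold I ∞ M]

/-- The change of coordinates from the preferred chart at `x` to the one at `y`. -/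
def chartChange (x y : M) : E → E := extChartAt I y ∘ (extChartAt I x).symm

variable {I} {x y : M} {z : E}

theorem chartChange_apply : chartChange I x y z = extChartAt I y ((extChartAt I x).symm z) := rfl

theorem symm_mem_nhds (hz : z ∈ (extChartAt I x).target)
    (hy : (extChartAt I x).symm z ∈ (extChartAt I y).source) :
    ∀ᶠ w in nhds z, w ∈ (extChartAt I x).target ∧
      (extChartAt I x).symm w ∈ (extChartAt I y).source :=
  ((isOpen_extChartAt_target x).mem_nhds hz |> fun h =>
    (eventually_mem_set.2 h).and ((continuousAt_extChartAt_symm'' hz).eventually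
      ((isOpen_extChartAt_source y).mem_nhds hy)))

theorem contDiffAt_chartChange (hz : z ∈ (extChartAt I x).target)
    (hy : (extChartAt I x).symm z ∈ (extChartAt I y).source) :
    ContDiffAt ℝ ∞ (chartChange I x y) z := by
  have h := contDiffWithinAt_ext_coord_change (I := I) (n := ∞) y x (y := z)
    (by rw [PartialEquiv.trans_source]; exact ⟨hz, hy⟩)
  rwa [I.range_eq_univ, contDiffWithinAt_univ] at h

theorem differentiableAt_chartChange (hz : z ∈ (extChartAt I x).target)
    (hy : (extChartAt I x).symm z ∈ (extChartAt I y).source) :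
    DifferentiableAt ℝ (chartChange I x y) z :=
  (contDiffAt_chartChange hz hy).differentiableAt (by simp)

theorem chartChange_mem_target (hy : (extChartAt I x).symm z ∈ (extChartAt I y).source) :
    chartChange I x y z ∈ (extChartAt I y).target := (extChartAt I y).map_source hy

theorem symm_chartChange (hy : (extChartAt I x).symm z ∈ (extChartAt I y).source) :
    (extChartAt I y).symm (chartChange I x y z) = (extChartAt I x).symm z :=
  (extChartAt I y).left_inv hy

theorem chartChange_comp {w : M} (hz : z ∈ (extChartAt I x).target)
    (hy : (extChartAt I x).symm z ∈ (extChartAt I y).source) :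
    chartChange I y w ∘ chartChange I x y =ᶠ[nhds z] chartChange I x w := by
  filter_upwards [symm_mem_nhds hz hy] with v hv
  rw [Function.comp_apply, chartChange_apply, symm_chartChange hv.2, chartChange_apply]

theorem fderiv_chartChange_comp {w : M} (hz : z ∈ (extChartAt I x).target)
    (hy : (extChartAt I x).symm z ∈ (extChartAt I y).source)
    (hw : (extChartAt I x).symm z ∈ (extChartAt I w).source) :
    fderiv ℝ (chartChange I y w) (chartChange I x y z) ∘L fderiv ℝ (chartChange I x y) z =
      fderiv ℝ (chartChange I x w) z := by
  rw [← (chartChange_comp (w := w) hz hy).fderiv_eq, fderiv_comp z _ (differentiableAt_chartChange hz hy)]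
  exact differentiableAt_chartChange (chartChange_mem_target hy) (by rwa [symm_chartChange hy])

theorem fderiv_chartChange_self (hz : z ∈ (extChartAt I x).target) :
    fderiv ℝ (chartChange I x x) z = ContinuousLinearMap.id ℝ E := by
  have : chartChange I x x =ᶠ[nhds z] id := by
    filter_upwards [(isOpen_extChartAt_target x).mem_nhds hz] with w hw
    exact (extChartAt I x).right_inv hw
  rw [this.fderiv_eq, fderiv_id]

/-- The differential of a change of coordinates, as an isomorphism. -/
def chartChangeEquiv (hz : z ∈ (extChartAt I x).target)
    (hy : (extChartAt I x).symm z ∈ (extChartAt I y).source) : E ≃L[ℝ] E :=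
  ContinuousLinearEquiv.equivOfInverse (fderiv ℝ (chartChange I x y) z)
    (fderiv ℝ (chartChange I y x) (chartChange I x y z))
    (fun v => by
      have h := fderiv_chartChange_comp (w := x) hz hy ((extChartAt I x).map_target hz)
      rw [fderiv_chartChange_self hz] at h
      exact congrArg (fun L => L v) h)
    (fun v => by
      have h1 := (extChartAt I x).right_inv hz
      have h2 : (extChartAt I y).symm (chartChange I x y z) ∈ (extChartAt I x).source := by
        rw [symm_chartChange hy]; exact (extChartAt I x).map_target hz
      have h := fderiv_chartChange_comp (w := y) (chartChange_mem_target hy) h2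
        (by rwa [symm_chartChange hy])
      have h3 : chartChange I y x (chartChange I x y z) = z := by
        rw [chartChange_apply, symm_chartChange hy, h1]
      rw [fderiv_chartChange_self (chartChange_mem_target hy), h3] at h
      exact congrArg (fun L => L v) h)

theorem coe_chartChangeEquiv (hz : z ∈ (extChartAt I x).target)
    (hy : (extChartAt I x).symm z ∈ (extChartAt I y).source) :
    (chartChangeEquiv hz hy : E →L[ℝ] E) = fderiv ℝ (chartChange I x y) z := rfl

/-- The tangent space at the image point is identified with `E` through the preferred chart there,
so the inverse chart is differentiated as a change of coordinates into that chart. -/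
theorem mfderiv_extChartAt_symm (hz : z ∈ (extChartAt I x).target) :
    (mfderiv 𝓘(ℝ, E) I (extChartAt I x).symm z : E →L[ℝ] E) =
      fderiv ℝ (chartChange I x ((extChartAt I x).symm z)) z := by
  have hd : MDifferentiableAt 𝓘(ℝ, E) I (extChartAt I x).symm z := by
    have h := mdifferentiableWithinAt_extChartAt_symm (I := I) hz
    rwa [I.range_eq_univ, mdifferentiableWithinAt_univ] at h
  rw [hd.mfderiv, ModelWithCorners.range_eq_univ, fderivWithin_univ]
  rfl

theorem metricInChart_apply
    (g : ∀ x : M, TangentSpace I x →L[ℝ] TangentSpace I x →L[ℝ] ℝ)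
    (hz : z ∈ (extChartAt I x).target) (hy : (extChartAt I x).symm z = y) (a b : E) :
    metricInChart I g x z a b = formOnModel I (g y) (fderiv ℝ (chartChange I x y) z a)
      (fderiv ℝ (chartChange I x y) z b) := by
  subst hy
  rw [← mfderiv_extChartAt_symm hz]
  rfl

theorem metricInChart_self (g : ∀ x : M, TangentSpace I x →L[ℝ] TangentSpace I x →L[ℝ] ℝ) (x : M) :
    metricInChart I g x (extChartAt I x x) = formOnModel I (g x) := by
  ext a b
  rw [metricInChart_apply g (mem_extChartAt_target x) (extChartAt_to_inv x),
    fderiv_chartChange_self (mem_extChartAt_target x)]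
  rfl

/-- The components of a metric in two charts are related by the change of coordinates. -/
theorem metricInChart_chartChange
    (g : ∀ x : M, TangentSpace I x →L[ℝ] TangentSpace I x →L[ℝ] ℝ)
    (hz : z ∈ (extChartAt I x).target) (hy : (extChartAt I x).symm z ∈ (extChartAt I y).source)
    (a b : E) :
    metricInChart I g x z a b = metricInChart I g y (chartChange I x y z)
      (fderiv ℝ (chartChange I x y) z a) (fderiv ℝ (chartChange I x y) z b) := by
  have h := fderiv_chartChange_comp (w := (extChartAt I x).symm z) hz hy
    (mem_extChartAt_source _)
  rw [metricInChart_apply g hz rfl, metricInChart_apply g (chartChange_mem_target hy)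
    (symm_chartChange hy), ← h]
  rfl

theorem eventually_metricInChart_chartChange
    (g : ∀ x : M, TangentSpace I x →L[ℝ] TangentSpace I x →L[ℝ] ℝ)
    (hz : z ∈ (extChartAt I x).target) (hy : (extChartAt I x).symm z ∈ (extChartAt I y).source) :
    ∀ᶠ w in nhds z, ∀ a b, metricInChart I g x w a b = metricInChart I g y (chartChange I x y w)
      (fderiv ℝ (chartChange I x y) w a) (fderiv ℝ (chartChange I x y) w b) := by
  filter_upwards [symm_mem_nhds hz hy] with w hw a b
  exact metricInChart_chartChange g hw.1 hw.2 a b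

/-- A function that is smooth near a chart domain is smooth in the chart. -/
theorem contDiffAt_comp_symm {F : Type*} [NormedAddCommGroup F] [NormedSpace ℝ F] {u : M → F}
    (hz : z ∈ (extChartAt I x).target) (hu : ContMDiffAt I 𝓘(ℝ, F) ∞ u ((extChartAt I x).symm z)) :
    ContDiffAt ℝ ∞ (u ∘ (extChartAt I x).symm) z := by
  rw [← contMDiffAt_iff_contDiffAt]
  exact hu.comp z ((contMDiffOn_extChartAt_symm x).contMDiffAt
    ((isOpen_extChartAt_target x).mem_nhds hz))

theorem comp_symm_eventuallyEq {F : Type*} (u : M → F) (hz : z ∈ (extChartAt I x).target)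
    (hy : (extChartAt I x).symm z ∈ (extChartAt I y).source) :
    u ∘ (extChartAt I x).symm =ᶠ[nhds z] (u ∘ (extChartAt I y).symm) ∘ chartChange I x y := by
  filter_upwards [symm_mem_nhds hz hy] with w hw
  simp only [Function.comp_apply]
  rw [symm_chartChange hw.2]

theorem mvfderiv_eq_fderiv {u : M → ℝ} (hu : ContMDiffAt I 𝓘(ℝ, ℝ) ∞ u x) :
    (mvfderiv I u x : E →L[ℝ] ℝ) = fderiv ℝ (u ∘ (extChartAt I x).symm) (extChartAt I x x) := by
  have h : mfderiv I 𝓘(ℝ, ℝ) u x = _ := (hu.mdifferentiableAt (by simp)).mfderiv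
  rw [I.range_eq_univ, fderivWithin_univ] at h
  exact h

theorem fderiv_comp_symm {u : M → ℝ} (hu : ContMDiff I 𝓘(ℝ, ℝ) ∞ u)
    (hz : z ∈ (extChartAt I x).target) (hy : (extChartAt I x).symm z = y) (a : E) :
    fderiv ℝ (u ∘ (extChartAt I x).symm) z a =
      (mvfderiv I u y : E →L[ℝ] ℝ) (fderiv ℝ (chartChange I x y) z a) := by
  have hy' : (extChartAt I x).symm z ∈ (extChartAt I y).source := by
    rw [hy]; exact mem_extChartAt_source y
  have h1 : chartChange I x y z = extChartAt I y y := by rw [chartChange_apply, hy]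
  have h2 : DifferentiableAt ℝ (u ∘ (extChartAt I y).symm) (chartChange I x y z) :=
    (contDiffAt_comp_symm (chartChange_mem_target hy') hu.contMDiffAt).differentiableAt (by simp)
  rw [(comp_symm_eventuallyEq u hz hy').fderiv_eq,
    fderiv_comp z h2 (differentiableAt_chartChange hz hy'), h1, ← mvfderiv_eq_fderiv
    (hu.contMDiffAt)]
  rfl

variable [FiniteDimensional ℝ E]
  (g : ContMDiffRiemannianMetric I ∞ E (TangentSpace I : M → Type _))

/-- The components are values of `g` on the local frames given by the trivialization over the chart
domain, which are smooth sections. In finite dimension smoothness of a form can be tested on fixed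
vectors. -/
theorem contDiffAt_metricInChart (hz : z ∈ (extChartAt I x).target) :
    ContDiffAt ℝ ∞ (metricInChart I g.inner x) z := by
  set e := trivializationAt E (TangentSpace I : M → Type _) x
  have hbase : e.baseSet = (chartAt H x).source := rfl
  have hsec : ∀ v : E, ∀ p ∈ e.baseSet, ContMDiffAt I (I.prod 𝓘(ℝ, E)) ∞
      (fun m => TotalSpace.mk' E (E := (TangentSpace I : M → Type _)) m (e.symmL ℝ m v)) p := by
    intro v p hp
    exact ContMDiffAt.clm_bundle_apply (F₁ := E) (E₁ := fun _ : M => E) (e.contMDiffAt_symmL hp)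
      (contMDiffAt_totalSpace.2 ⟨contMDiffAt_id, contMDiffAt_const⟩)
  have hfun : ∀ v w : E, ∀ p ∈ e.baseSet, ContMDiffAt I 𝓘(ℝ, ℝ) ∞
      (fun m => g.inner m (e.symmL ℝ m v) (e.symmL ℝ m w)) p := by
    intro v w p hp
    have := ContMDiffAt.clm_bundle_apply₂ (F₁ := E) (F₂ := E) (F₃ := ℝ) (E₃ := fun _ : M => ℝ)
      g.contMDiff.contMDiffAt (hsec v p hp) (hsec w p hp)
    exact (contMDiffAt_totalSpace.1 this).2
  suffices h : ContDiffOn ℝ ∞ (metricInChart I g.inner x) (extChartAt I x).target from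
    h.contDiffAt ((isOpen_extChartAt_target x).mem_nhds hz)
  rw [contDiffOn_clm_apply]
  intro v
  rw [contDiffOn_clm_apply]
  intro w z hz
  have hp : (extChartAt I x).symm z ∈ e.baseSet := by
    rw [hbase, ← extChartAt_source I]
    exact (extChartAt I x).map_target hz
  refine ((contDiffAt_comp_symm hz (hfun v w _ hp)).congr_of_eventuallyEq ?_).contDiffWithinAt
  filter_upwards [(isOpen_extChartAt_target x).mem_nhds hz] with y hy
  have hy' : (extChartAt I x).symm y ∈ (chartAt H x).source := by
    rw [← extChartAt_source I]
    exact (extChartAt I x).map_target hy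
  -- The inverse trivialization is the differential of the inverse chart, so the frame is the
  -- coordinate frame.
  have hs : e.symmL ℝ ((extChartAt I x).symm y) =
      fderiv ℝ (chartChange I x ((extChartAt I x).symm y)) y := by
    rw [TangentBundle.symmL_trivializationAt hy', (extChartAt I x).right_inv hy,
      I.range_eq_univ, mfderivWithin_univ]
    exact mfderiv_extChartAt_symm hy
  rw [metricInChart_apply g.inner hy rfl, Function.comp_apply, hs]
  rfl

theorem isMetricOn_metricInChart (x : M) :
    IsMetricOn (metricInChart I g.inner x) (extChartAt I x).target where
  isOpen := isOpen_extChartAt_target x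
  contDiffAt _ hz := contDiffAt_metricInChart g hz
  symm z hz v w := by
    rw [metricInChart_apply g.inner hz rfl, metricInChart_apply g.inner hz rfl]
    exact g.symm _ _ _
  pos z hz v hv := by
    rw [metricInChart_apply g.inner hz rfl]
    refine g.pos _ _ fun h => hv ?_
    exact (chartChangeEquiv hz (mem_extChartAt_source _)).map_eq_zero_iff.1 h

theorem gradNormSq_eq {u : M → ℝ} (hu : ContMDiff I 𝓘(ℝ, ℝ) ∞ u)
    (hz : z ∈ (extChartAt I x).target) (hy : (extChartAt I x).symm z = y) :
    gradNormSq I g.inner u y = metricInChart I g.inner x z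
      (gradient (metricInChart I g.inner x) (u ∘ (extChartAt I x).symm) z)
      (gradient (metricInChart I g.inner x) (u ∘ (extChartAt I x).symm) z) := by
  have hy' : (extChartAt I x).symm z ∈ (extChartAt I y).source := by
    rw [hy]; exact mem_extChartAt_source y
  have hG := isMetricOn_metricInChart g x
  have hi : (formOnModel I (g.inner y)).IsInvertible := by
    rw [← metricInChart_self g.inner y]
    exact (isMetricOn_metricInChart g y).isInvertible (mem_extChartAt_target y)
  have h := sharp_pullback (chartChangeEquiv hz hy') (hG.isInvertible hz) hi
    (fun a b => metricInChart_apply g.inner hz hy a b) (mvfderiv I u y : E →L[ℝ] ℝ)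
  have h1 : (mvfderiv I u y : E →L[ℝ] ℝ) ∘L (chartChangeEquiv hz hy' : E →L[ℝ] E) =
      fderiv ℝ (u ∘ (extChartAt I x).symm) z := by
    ext a
    exact (fderiv_comp_symm hu hz hy a).symm
  have h3 := congrArg (fun ℓ => chartChangeEquiv hz hy' (sharp (metricInChart I g.inner x z) ℓ)) h1
  rw [metricInChart_apply g.inner hz hy]
  have h2 : (grad I g.inner u y : E) = fderiv ℝ (chartChange I x y) z
      (gradient (metricInChart I g.inner x) (u ∘ (extChartAt I x).symm) z) := h.symm.trans h3
  rw [← h2]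
  rfl

/-- The left side is computed in a chart that varies with the point. A single chart for all nearby
points is needed before the Laplacian can be differentiated. -/
theorem laplacian_eq {u : M → ℝ} (hu : ContMDiff I 𝓘(ℝ, ℝ) ∞ u)
    (hz : z ∈ (extChartAt I x).target) (hy : (extChartAt I x).symm z = y) :
    laplacian I g.inner u y =
      LocalRiem.laplacian (metricInChart I g.inner x) (u ∘ (extChartAt I x).symm) z := by
  have hy' : (extChartAt I x).symm z ∈ (extChartAt I y).source := by
    rw [hy]; exact mem_extChartAt_source y
  have h1 : chartChange I x y z = extChartAt I y y := by rw [chartChange_apply, hy]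
  rw [laplacian_pullback (isMetricOn_metricInChart g x) hz (isMetricOn_metricInChart g y)
    (chartChange_mem_target hy') (contDiffAt_chartChange hz hy') (chartChangeEquiv hz hy')
    (coe_chartChangeEquiv hz hy') (eventually_metricInChart_chartChange g.inner hz hy')
    (contDiffAt_comp_symm (chartChange_mem_target hy') hu.contMDiffAt)
    (comp_symm_eventuallyEq u hz hy'), h1]
  rfl

end Charts

end Riem

namespace LocalRiem

/-! ### The bitension field depends only on germs -/

section Congr

variable {E : Type*} [NormedAddCommGroup E] [NormedSpace ℝ E]
  {F : Type*} [NormedAddCommGroup F] [NormedSpace ℝ F]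
  {G G' : E → E →L[ℝ] E →L[ℝ] ℝ} {H : F → F →L[ℝ] F →L[ℝ] ℝ} {φ φ' V V' : E → F} {z : E}

theorem christoffel_congr (hG : G =ᶠ[nhds z] G') : christoffel G z = christoffel G' z := by
  rw [christoffel, christoffel, hG.fderiv_eq, hG.self_of_nhds]

theorem covAlong_congr (hφ : φ =ᶠ[nhds z] φ') (hV : V =ᶠ[nhds z] V') :
    covAlong H φ V z = covAlong H φ' V' z := by
  ext X
  rw [covAlong, covAlong, hφ.fderiv_eq, hV.fderiv_eq, hφ.self_of_nhds, hV.self_of_nhds]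

theorem eventuallyEq_covAlong (hφ : φ =ᶠ[nhds z] φ') (hV : V =ᶠ[nhds z] V') (X : E) :
    (fun y => covAlong H φ V y X) =ᶠ[nhds z] fun y => covAlong H φ' V' y X := by
  filter_upwards [hφ.eventuallyEq_nhds, hV.eventuallyEq_nhds] with y h1 h2
  rw [covAlong_congr h1 h2]

variable [FiniteDimensional ℝ E]

theorem tension_congr (hG : G =ᶠ[nhds z] G') (hφ : φ =ᶠ[nhds z] φ') :
    tension G H φ z = tension G' H φ' z := by
  have h : ∀ Y, (fun y => fderiv ℝ φ y Y) =ᶠ[nhds z] fun y => fderiv ℝ φ' y Y := by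
    intro Y
    filter_upwards [hφ.fderiv (𝕜 := ℝ)] with y hy
    rw [hy]
  rw [tension, tension, hG.self_of_nhds]
  refine trace_congr fun X Y => ?_
  rw [covAlong_congr hφ (h Y), christoffel_congr hG, hφ.fderiv_eq]

theorem bitension_congr (hG : G =ᶠ[nhds z] G') (hφ : φ =ᶠ[nhds z] φ') :
    bitension G H φ z = bitension G' H φ' z := by
  have h : tension G H φ =ᶠ[nhds z] tension G' H φ' := by
    filter_upwards [hG.eventuallyEq_nhds, hφ.eventuallyEq_nhds] with y h1 h2
    exact tension_congr h1 h2
  rw [bitension, bitension, jacobi, jacobi, hG.self_of_nhds]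
  congr 1
  · rw [hφ.fderiv_eq, hφ.self_of_nhds, h.self_of_nhds]
  · refine trace_congr fun X Y => ?_
    rw [covAlong_congr hφ (eventuallyEq_covAlong hφ h Y), christoffel_congr hG,
      covAlong_congr hφ h]

end Congr

end LocalRiem

namespace Riem

open LocalRiem Filter

/-! ### Charts of the tangent bundle -/

section TangentCharts

variable {E : Type*} [NormedAddCommGroup E] [NormedSpace ℝ E]
  {H : Type*} [TopologicalSpace H] {I : ModelWithCorners ℝ E H} [I.Boundaryless]
  {M : Type*} [TopologicalSpace M] [ChartedSpace H M] [IsManifold I ∞ M]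
  {p q : TangentBundle I M} {z : E × E}

theorem extChartAt_tangent_target :
    (extChartAt I.tangent p).target = (extChartAt I p.1).target ×ˢ Set.univ := by
  ext z
  simp only [extChartAt_target, ModelWithCorners.range_eq_univ, Set.inter_univ, Set.mem_preimage,
    Set.mem_prod, Set.mem_univ, and_true]
  exact TangentBundle.mem_chart_target_iff _ _

theorem extChartAt_tangent_apply (r : TangentBundle I M) :
    extChartAt I.tangent q r = (extChartAt I q.1 r.1, tangentCoordChange I r.1 q.1 r.1 r.2) := rfl

theorem extChartAt_tangent_symm_snd :
    ((extChartAt I.tangent p).symm z).2 = tangentCoordChange I p.1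
      ((extChartAt I p.1).symm z.1) ((extChartAt I p.1).symm z.1) z.2 := rfl

theorem tangentCoordChange_eq_fderiv {x y : M} {w : E} (hw : w ∈ (extChartAt I x).target) :
    tangentCoordChange I x y ((extChartAt I x).symm w) = fderiv ℝ (chartChange I x y) w := by
  rw [tangentCoordChange_def, (extChartAt I x).right_inv hw, I.range_eq_univ, fderivWithin_univ]
  rfl

theorem chartChange_tangent (hz : z.1 ∈ (extChartAt I p.1).target)
    (hq : (extChartAt I p.1).symm z.1 ∈ (extChartAt I q.1).source) :
    chartChange I.tangent p q z =
      (chartChange I p.1 q.1 z.1, fderiv ℝ (chartChange I p.1 q.1) z.1 z.2) := by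
  rw [chartChange_apply, extChartAt_tangent_apply, extChartAt_tangent_symm_snd]
  refine Prod.ext rfl ?_
  rw [← tangentCoordChange_eq_fderiv hz]
  exact tangentCoordChange_comp ⟨⟨(extChartAt I p.1).map_target hz, mem_extChartAt_source _⟩, hq⟩

/-- Induced charts change by `(x, u) ↦ (ψ x, Dψ_x u)`. The `D²ψ` term in the fibre component is what
the Christoffel part of the connection map compensates. -/
theorem fderiv_chartChange_tangent (hz : z.1 ∈ (extChartAt I p.1).target)
    (hq : (extChartAt I p.1).symm z.1 ∈ (extChartAt I q.1).source) (ξ : E × E) :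
    fderiv ℝ (chartChange I.tangent p q) z ξ =
      (fderiv ℝ (chartChange I p.1 q.1) z.1 ξ.1,
        fderiv ℝ (fderiv ℝ (chartChange I p.1 q.1)) z.1 ξ.1 z.2 +
          fderiv ℝ (chartChange I p.1 q.1) z.1 ξ.2) := by
  set ψ := chartChange I p.1 q.1
  have hψ : ContDiffAt ℝ ∞ ψ z.1 := contDiffAt_chartChange hz hq
  have hψd := hψ.differentiableAt (by simp)
  have hψ2 : DifferentiableAt ℝ (fderiv ℝ ψ) z.1 :=
    (hψ.fderiv_right (m := ∞) le_rfl).differentiableAt (by simp)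
  have e : chartChange I.tangent p q =ᶠ[nhds z]
      fun w : E × E => ((ψ ∘ Prod.fst) w, (fderiv ℝ ψ ∘ Prod.fst) w w.2) := by
    filter_upwards [continuousAt_fst.eventually (symm_mem_nhds hz hq)] with w hw
    exact chartChange_tangent hw.1 hw.2
  have h1 : DifferentiableAt ℝ (ψ ∘ Prod.fst : E × E → E) z := hψd.comp z differentiableAt_fst
  have h2 : DifferentiableAt ℝ (fderiv ℝ ψ ∘ Prod.fst : E × E → E →L[ℝ] E) z :=
    hψ2.comp z differentiableAt_fst
  rw [e.fderiv_eq, (h1.hasFDerivAt.prodMk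
    (h2.clm_apply differentiableAt_snd).hasFDerivAt).fderiv, ContinuousLinearMap.prod_apply,
    fderiv_clm h2 differentiableAt_snd, fderiv_comp z hψd differentiableAt_fst,
    fderiv_comp z hψ2 differentiableAt_fst, fderiv_fst, fderiv_snd]
  rfl

variable [FiniteDimensional ℝ E]
  (g : ContMDiffRiemannianMetric I ∞ E (TangentSpace I : M → Type _))

/-- The components of the Mus-Gradient metric in the charts of the tangent bundle. -/
theorem metricInChart_musGradient {f : M → ℝ} (hf : ContMDiff I 𝓘(ℝ, ℝ) ∞ f)
    (hz : z.1 ∈ (extChartAt I p.1).target) :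
    metricInChart I.tangent (musGradient I g.inner f) p z =
      musMetric (metricInChart I g.inner p.1) (f ∘ (extChartAt I p.1).symm) z := by
  have hz' : z ∈ (extChartAt I.tangent p).target := by
    rw [extChartAt_tangent_target]; exact ⟨hz, trivial⟩
  obtain ⟨q, hq⟩ : ∃ q, (extChartAt I.tangent p).symm z = q := ⟨_, rfl⟩
  have hq1 : (extChartAt I p.1).symm z.1 = q.1 := by rw [← hq]; rfl
  have hqs : (extChartAt I p.1).symm z.1 ∈ (extChartAt I q.1).source := by
    rw [hq1]; exact mem_extChartAt_source _
  have hq2 : (q.2 : E) = fderiv ℝ (chartChange I p.1 q.1) z.1 z.2 := by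
    subst hq
    rw [← tangentCoordChange_eq_fderiv hz]
    rfl
  have hc : chartChange I p.1 q.1 z.1 = extChartAt I q.1 q.1 := by rw [chartChange_apply, hq1]
  have hψ : ContDiffAt ℝ ∞ (chartChange I p.1 q.1) z.1 := contDiffAt_chartChange hz hqs
  have hΓ := christoffel_pullback (isMetricOn_metricInChart g p.1) hz
    (isMetricOn_metricInChart g q.1) (chartChange_mem_target hqs) hψ
    (chartChangeEquiv hz hqs).surjective (eventually_metricInChart_chartChange g.inner hz hqs)
  -- The connection map is tensorial: the second derivative of the change of charts is exactly the
  -- inhomogeneous term in the law for the Christoffel symbols.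
  have aux : ∀ (u : E) (L : E × E →L[ℝ] E), u = fderiv ℝ (chartChange I p.1 q.1) z.1 z.2 →
      (∀ η, L η = η.2 + christoffel (metricInChart I g.inner q.1) (extChartAt I q.1 q.1) η.1 u) →
      ∀ ξ, L (fderiv ℝ (chartChange I.tangent p q) z ξ) =
        fderiv ℝ (chartChange I p.1 q.1) z.1 (connMap (metricInChart I g.inner p.1) z ξ) := by
    intro u L hu hL ξ
    rw [hL, fderiv_chartChange_tangent hz hqs, connMap_apply, map_add, ← hΓ, hu, ← hc]
    exact (show ∀ a b c : E, a + b + c = b + (c + a) from fun a b c => by abel) _ _ _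
  have hconn := aux q.2 (connectionMap I g.inner q) hq2 fun _ => rfl
  refine ContinuousLinearMap.ext fun ξ => ContinuousLinearMap.ext fun η => ?_
  have aux' : ∀ (L : E × E →L[ℝ] E) (ℓ : E →L[ℝ] ℝ),
      (∀ ξ, L (fderiv ℝ (chartChange I.tangent p q) z ξ) =
        fderiv ℝ (chartChange I p.1 q.1) z.1 (connMap (metricInChart I g.inner p.1) z ξ)) →
      (∀ a, fderiv ℝ (f ∘ (extChartAt I p.1).symm) z.1 a =
        ℓ (fderiv ℝ (chartChange I p.1 q.1) z.1 a)) →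
      formOnModel I (g.inner q.1) (fderiv ℝ (chartChange I.tangent p q) z ξ).1
          (fderiv ℝ (chartChange I.tangent p q) z η).1 +
        (formOnModel I (g.inner q.1) (L (fderiv ℝ (chartChange I.tangent p q) z ξ))
          (L (fderiv ℝ (chartChange I.tangent p q) z η)) +
        ℓ (L (fderiv ℝ (chartChange I.tangent p q) z ξ)) *
          ℓ (L (fderiv ℝ (chartChange I.tangent p q) z η))) =
      musMetric (metricInChart I g.inner p.1) (f ∘ (extChartAt I p.1).symm) z ξ η := by
    intro L ℓ hL hℓ
    rw [hL, hL, fderiv_chartChange_tangent hz hqs, fderiv_chartChange_tangent hz hqs,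
      musMetric_apply, fibreMetric_apply, metricInChart_apply g.inner hz hq1,
      metricInChart_apply g.inner hz hq1, hℓ, hℓ]
  rw [metricInChart_apply _ hz' hq]
  exact aux' (connectionMap I g.inner q) (mvfderiv I f q.1) hconn (fderiv_comp_symm hf hz hq1)

theorem writtenInExtChartAt_proj :
    writtenInExtChartAt I.tangent I p (fun q : TangentBundle I M => q.1)
      =ᶠ[nhds (extChartAt I.tangent p p)] (Prod.fst : E × E → E) := by
  filter_upwards [(isOpen_extChartAt_target p).mem_nhds (mem_extChartAt_target p)] with z hz
  rw [extChartAt_tangent_target] at hz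
  exact (extChartAt I p.1).right_inv hz.1

/-- The function which is constant if and only if the projection is biharmonic. -/
def biharmonicPotential (lam : ℝ) (α : M → ℝ) (x : M) : ℝ :=
  lam * Real.log (α x) + 1 / 2 * laplacian I g.inner (fun y => Real.log (α y)) x
    + 1 / 8 * gradNormSq I g.inner (fun y => Real.log (α y)) x

/-! ### The potential on the manifold and the conclusion -/

variable {f α : M → ℝ}

theorem log_alpha_comp_symm (hf : ContMDiff I 𝓘(ℝ, ℝ) ∞ f)
    (hα : ∀ x, α x = 1 + gradNormSq I g.inner f x) {x : M} {w : E}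
    (hw : w ∈ (extChartAt I x).target) :
    Real.log (α ((extChartAt I x).symm w)) = logAlpha (metricInChart I g.inner x)
      (f ∘ (extChartAt I x).symm) w := by
  rw [hα, gradNormSq_eq g hf hw rfl, logAlpha]

theorem log_alpha_eventuallyEq (hf : ContMDiff I 𝓘(ℝ, ℝ) ∞ f)
    (hα : ∀ x, α x = 1 + gradNormSq I g.inner f x) {x : M} {w : E}
    (hw : w ∈ (extChartAt I x).target) :
    (fun y => Real.log (α y)) ∘ (extChartAt I x).symm =ᶠ[nhds w]
      logAlpha (metricInChart I g.inner x) (f ∘ (extChartAt I x).symm) := by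
  filter_upwards [(isOpen_extChartAt_target x).mem_nhds hw] with v hv
  exact log_alpha_comp_symm g hf hα hv

theorem contDiffAt_local {x : M} (hf : ContMDiff I 𝓘(ℝ, ℝ) ∞ f) :
    ∀ w ∈ (extChartAt I x).target, ContDiffAt ℝ ∞ (f ∘ (extChartAt I x).symm) w :=
  fun _ hw => contDiffAt_comp_symm hw hf.contMDiffAt

theorem contMDiff_log_alpha (hf : ContMDiff I 𝓘(ℝ, ℝ) ∞ f)
    (hα : ∀ x, α x = 1 + gradNormSq I g.inner f x) :
    ContMDiff I 𝓘(ℝ, ℝ) ∞ (fun y => Real.log (α y)) := by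
  intro x
  have h := (isMetricOn_metricInChart g x).contDiffAt_logAlpha (contDiffAt_local hf)
    (mem_extChartAt_target x)
  refine (h.contMDiffAt.comp x (contMDiffAt_extChartAt (I := I) (x := x))).congr_of_eventuallyEq ?_
  filter_upwards [extChartAt_source_mem_nhds (I := I) x] with y hy
  rw [Function.comp_apply, ← log_alpha_comp_symm g hf hα ((extChartAt I x).map_source hy),
    (extChartAt I x).left_inv hy]

theorem biharmonicPotential_comp_symm (hf : ContMDiff I 𝓘(ℝ, ℝ) ∞ f)
    (hα : ∀ x, α x = 1 + gradNormSq I g.inner f x) (lam : ℝ) {x : M} {w : E}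
    (hw : w ∈ (extChartAt I x).target) :
    biharmonicPotential g lam α ((extChartAt I x).symm w) =
      potential lam (metricInChart I g.inner x)
        (logAlpha (metricInChart I g.inner x) (f ∘ (extChartAt I x).symm)) w := by
  have hs := contMDiff_log_alpha g hf hα
  have e := log_alpha_eventuallyEq g hf hα hw
  have hsl := contDiffAt_local (x := x) hs w hw
  have hd := (isMetricOn_metricInChart g x).contDiffAt_logAlpha (contDiffAt_local hf) hw
  have h1 : LocalRiem.laplacian (metricInChart I g.inner x)
      ((fun y => Real.log (α y)) ∘ (extChartAt I x).symm) w =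
      LocalRiem.laplacian (metricInChart I g.inner x)
      (logAlpha (metricInChart I g.inner x) (f ∘ (extChartAt I x).symm)) w := by
    rw [IsMetricOn.laplacian_eq_trace_hessian hsl, IsMetricOn.laplacian_eq_trace_hessian hd,
      hessian, hessian, (e.fderiv (𝕜 := ℝ)).fderiv_eq, e.fderiv_eq]
  rw [biharmonicPotential, potential, gradNormSq_eq g hs hw rfl,
    laplacian_eq g hs hw rfl, log_alpha_comp_symm g hf hα hw, h1, LocalRiem.gradient,
    LocalRiem.gradient, e.fderiv_eq]

theorem biharmonicPotential_eventuallyEq (hf : ContMDiff I 𝓘(ℝ, ℝ) ∞ f)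
    (hα : ∀ x, α x = 1 + gradNormSq I g.inner f x) (lam : ℝ) {x : M} {w : E}
    (hw : w ∈ (extChartAt I x).target) :
    biharmonicPotential g lam α ∘ (extChartAt I x).symm =ᶠ[nhds w]
      potential lam (metricInChart I g.inner x)
        (logAlpha (metricInChart I g.inner x) (f ∘ (extChartAt I x).symm)) := by
  filter_upwards [(isOpen_extChartAt_target x).mem_nhds hw] with v hv
  exact biharmonicPotential_comp_symm g hf hα lam hv

theorem differentiableAt_biharmonicPotential (hf : ContMDiff I 𝓘(ℝ, ℝ) ∞ f)
    (hα : ∀ x, α x = 1 + gradNormSq I g.inner f x) (lam : ℝ) {x : M} {w : E}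
    (hw : w ∈ (extChartAt I x).target) :
    DifferentiableAt ℝ (biharmonicPotential g lam α ∘ (extChartAt I x).symm) w := by
  have hG := isMetricOn_metricInChart g x
  exact ((hG.contDiffAt_potential (fun v hv => hG.contDiffAt_logAlpha (contDiffAt_local hf) hv)
    hw lam).differentiableAt (by simp)).congr_of_eventuallyEq
      (biharmonicPotential_eventuallyEq g hf hα lam hw)

/-- The bitension field of the projection is minus the gradient of the potential. -/
theorem bitension_proj_eq_zero_iff (hf : ContMDiff I 𝓘(ℝ, ℝ) ∞ f)
    (hα : ∀ x, α x = 1 + gradNormSq I g.inner f x) {lam : ℝ}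
    (hE : ∀ (x : M) (X : TangentSpace I x), ricci I g.inner x X = lam • X)
    (p : TangentBundle I M) :
    bitension I.tangent I (musGradient I g.inner f) g.inner (fun q => q.1) p = 0 ↔
      fderiv ℝ (biharmonicPotential g lam α ∘ (extChartAt I p.1).symm) (extChartAt I p.1 p.1)
        = 0 := by
  have hG := isMetricOn_metricInChart g p.1
  have hp : (extChartAt I.tangent p p).1 ∈ (extChartAt I p.1).target := mem_extChartAt_target p.1
  have hK : metricInChart I.tangent (musGradient I g.inner f) p =ᶠ[nhds (extChartAt I.tangent p p)]
      musMetric (metricInChart I g.inner p.1) (f ∘ (extChartAt I p.1).symm) := by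
    filter_upwards [continuousAt_fst.eventually ((isOpen_extChartAt_target p.1).mem_nhds hp)]
      with z hz
    exact metricInChart_musGradient g hf hz
  have h1 : (bitension I.tangent I (musGradient I g.inner f) g.inner (fun q => q.1) p : E) =
      LocalRiem.bitension (musMetric (metricInChart I g.inner p.1)
        (f ∘ (extChartAt I p.1).symm)) (metricInChart I g.inner p.1) Prod.fst
        (extChartAt I.tangent p p) :=
    bitension_congr (F := E) hK writtenInExtChartAt_proj
  have h2 := hG.apply_bitension_fst (contDiffAt_local hf) (lam := lam)
    (p := extChartAt I.tangent p p) hp (fun X => hE p.1 X)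
  have h3 := (biharmonicPotential_eventuallyEq g hf hα lam (mem_extChartAt_target p.1)).fderiv_eq
    (𝕜 := ℝ)
  have key : LocalRiem.bitension (musMetric (metricInChart I g.inner p.1)
      (f ∘ (extChartAt I p.1).symm)) (metricInChart I g.inner p.1) Prod.fst
      (extChartAt I.tangent p p) = (0 : E) ↔
      fderiv ℝ (biharmonicPotential g lam α ∘ (extChartAt I p.1).symm) (extChartAt I p.1 p.1)
        = 0 := by
    rw [h3]
    constructor
    · intro h
      ext c
      have := h2 c
      rw [h] at this
      simpa using this.symm
    · intro h
      apply eq_of_forall_apply_eq (hG.isInvertible hp)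
      intro c
      rw [h2 c]
      have : (extChartAt I.tangent p p).1 = extChartAt I p.1 p.1 := rfl
      rw [this, h]
      simp
  exact ⟨fun h => key.1 (h1.symm.trans h), fun h => h1.trans (key.2 h)⟩

/-- A function on a connected manifold whose differential vanishes in all preferred charts is
constant. -/
theorem exists_const_of_fderiv_eq_zero [ConnectedSpace M] {u : M → ℝ}
    (hd : ∀ x : M, ∀ w ∈ (extChartAt I x).target,
      DifferentiableAt ℝ (u ∘ (extChartAt I x).symm) w)
    (h0 : ∀ x : M, fderiv ℝ (u ∘ (extChartAt I x).symm) (extChartAt I x x) = 0) :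
    ∃ c, ∀ x, u x = c := by
  have hzero : ∀ x : M, ∀ w ∈ (extChartAt I x).target,
      fderiv ℝ (u ∘ (extChartAt I x).symm) w = 0 := by
    intro x w hw
    -- The hypothesis concerns chart centres only, so the differential at `w` is compared with the
    -- one in the preferred chart of the point that `w` represents.
    have hs := mem_extChartAt_source (I := I) ((extChartAt I x).symm w)
    rw [(comp_symm_eventuallyEq u hw hs).fderiv_eq, fderiv_comp w
      (hd _ _ (chartChange_mem_target hs)) (differentiableAt_chartChange hw hs)]
    have := h0 ((extChartAt I x).symm w)
    rw [chartChange_apply, this, ContinuousLinearMap.zero_comp]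
  have hloc : IsLocallyConstant u := by
    rw [IsLocallyConstant.iff_eventually_eq]
    intro x
    obtain ⟨r, hr, hball⟩ := Metric.isOpen_iff.1 (isOpen_extChartAt_target (I := I) x) _
      (mem_extChartAt_target x)
    filter_upwards [extChartAt_source_mem_nhds (I := I) x,
      (continuousAt_extChartAt (I := I) x).eventually (Metric.ball_mem_nhds _ hr)] with y hy hy'
    have h := Metric.isOpen_ball.is_const_of_fderiv_eq_zero (𝕜 := ℝ)
      (convex_ball (extChartAt I x x) r).isPreconnected
      (f := u ∘ (extChartAt I x).symm)
      (fun w hw => (hd x w (hball hw)).differentiableWithinAt)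
      (fun w hw => hzero x w (hball hw)) hy' (Metric.mem_ball_self hr)
    rwa [Function.comp_apply, Function.comp_apply, (extChartAt I x).left_inv hy,
      extChartAt_to_inv] at h
  obtain ⟨x₀⟩ := (inferInstance : Nonempty M)
  exact ⟨u x₀, fun x => hloc.apply_eq_of_preconnectedSpace x x₀⟩

theorem isBiharmonic_proj_iff [ConnectedSpace M] (hf : ContMDiff I 𝓘(ℝ, ℝ) ∞ f)
    (hα : ∀ x, α x = 1 + gradNormSq I g.inner f x) {lam : ℝ}
    (hE : ∀ (x : M) (X : TangentSpace I x), ricci I g.inner x X = lam • X) :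
    IsBiharmonic I.tangent I (musGradient I g.inner f) g.inner
        (fun p : TangentBundle I M => p.1) ↔ ∃ c : ℝ, ∀ x : M, biharmonicPotential g lam α x = c := by
  constructor
  · rintro ⟨-, h⟩
    refine exists_const_of_fderiv_eq_zero
      (fun x w hw => differentiableAt_biharmonicPotential g hf hα lam hw) fun x => ?_
    -- The condition on the potential depends only on the base point, so any vector over `x` would
    -- serve.
    exact (bitension_proj_eq_zero_iff g hf hα hE ⟨x, 0⟩).1 (h _)
  · rintro ⟨c, hc⟩
    refine ⟨Bundle.contMDiff_proj (TangentSpace I : M → Type _), fun p => ?_⟩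
    rw [bitension_proj_eq_zero_iff g hf hα hE]
    have : biharmonicPotential g lam α ∘ (extChartAt I p.1).symm = fun _ => c := by
      ext w; exact hc _
    rw [this]
    exact fderiv_const_apply c

end TangentCharts

end Riem

end

theorem mainTheorem11 {m : ℕ} {M : Type*} [TopologicalSpace M]
    [ChartedSpace (EuclideanSpace ℝ (Fin m)) M] [IsManifold (𝓡 m) ∞ M] [ConnectedSpace M]
    (g : ContMDiffRiemannianMetric (𝓡 m) ∞ (EuclideanSpace ℝ (Fin m))
      (TangentSpace (𝓡 m) : M → Type _))
    (lam : ℝ) (hEinstein : ∀ (x : M) (X : TangentSpace (𝓡 m) x),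
      Riem.ricci (𝓡 m) g.inner x X = lam • X)
    (f : M → ℝ) (hf : ContMDiff (𝓡 m) 𝓘(ℝ, ℝ) ∞ f) (hpos : ∀ x, 0 < f x)
    (hgrad : ∀ x, Riem.grad (𝓡 m) g.inner f x ≠ 0)
    (α : M → ℝ) (hα : ∀ x, α x = 1 + Riem.gradNormSq (𝓡 m) g.inner f x) :
    Riem.IsBiharmonic (𝓡 m).tangent (𝓡 m) (Riem.musGradient (𝓡 m) g.inner f) g.inner
        (fun p : TangentBundle (𝓡 m) M => p.1) ↔
      ∃ c : ℝ, ∀ x : M,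
        lam * Real.log (α x)
          + 1 / 2 * Riem.laplacian (𝓡 m) g.inner (fun y => Real.log (α y)) x
          + 1 / 8 * Riem.gradNormSq (𝓡 m) g.inner (fun y => Real.log (α y)) x = c :=
  Riem.isBiharmonic_proj_iff g hf hα hEinstein
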